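/- Let $\mathbb D$ be the open unit disc and let $\mathcal A$ be the Neil algebra: the continuous functions $a$ on $\overline{\mathbb D}$ that are analytic in $\mathbb D$ and satisfy $a'(0)=0$. For $F\in M_n(\mathcal A)$ put $\|F\|_n=\sup_{z\in\mathbb D}\|F(z)\|$, with the operator norm of matrices on $\mathbb C^n$. A *representation* of $\mathcal A$ on a complex Hilbert space $H$ is a multiplicative linear map $\rho:\mathcal A\to B(H)$. It is *unital* if $\rho(1)=I$; *completely contractive* if $\|(\rho(F_{jk}))_{j,k}\|_{B(H^{\oplus n})}\le\|F\|_n$ for all $n$ and all $F=(F_{jk})\in M_n(\mathcal A)$; *pure* if $\bigcap_a\rho(a)H=\{0\}$, where $a$ runs over the elements of $\mathcal A$ that have no zero on the unit circle. A representation $\pi$ on $H$ is *extremal* if, whenever $\rho$ is a completely contractive representation of $\mathcal A$ on a Hilbert space $K$ and $V:H\to K$ is an isometry with $\pi(a)=V^*\rho(a)V$ for all $a\in\mathcal A$, one has $V\pi(a)=\rho(a)V$ for all $a\in\mathcal A$. Representations $\rho$ on $H$ and $\sigma$ on $H'$ are *unitarily equivalent* if there is a unitary $U:H\to H'$ with $U\rho(a)=\sigma(a)U$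 for all $a\in\mathcal A$. For a complex Hilbert space $\mathcal N$ let $H^2_{\mathcal N}$ be the Hardy space of $\mathcal N$-valued analytic functions $f$ on $\mathbb D$ with $\|f\|^2=\sup_{0<r<1}\frac1{2\pi}\int_0^{2\pi}\|f(re^{it})\|^2\,dt<\infty$, and let $\mathcal N\oplus z\mathcal N\subset H^2_{\mathcal N}$ be the subspace of the functions $z\mapsto c+zd$ with $c,d\in\mathcal N$. For a subspace $\mathcal V$ of $\mathcal N\oplus z\mathcal N$ let $\pi_{\mathcal V}$ be the representation of $\mathcal A$ on $H^2_{\mathcal N}\ominus\mathcal V$ given by $\pi_{\mathcal V}(a)f=af$. **Theorem.** For every Hilbert space $\mathcal N$ and every subspace $\mathcal V\subseteq\mathcal N\oplus z\mathcal N$, the representation $\pi_{\mathcal V}$ is unital, pure, completely contractive and extremal. Conversely, if $\nu$ is a unital, pure, extremal, completely contractive representation of $\mathcal A$ on a Hilbert space, then there are a Hilbert space $\mathcal N$ and a closed subspace $\mathcal V\subseteq\mathcal N\oplus z\mathcal N$ such that $\nu$ is unitarily equivalent to $\pi_{\mathcal V}$. -/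

import Mathlib

open scoped InnerProductSpace

noncomputable section

namespace NeilRep

/-! ### Taylor coefficients and integral means -/

section Taylor

variable {N : Type*} [NormedAddCommGroup N] [InnerProductSpace ℂ N] [CompleteSpace N]

/-- The `n`-th Taylor coefficient at `0`. -/
def taylorCoeff (f : ℂ → N) (n : ℕ) : N := (n.factorial : ℂ)⁻¹ • iteratedDeriv n f 0

/-- The integral mean `(2π)⁻¹ ∫₀^{2π} ‖f(r e^{it})‖² dt`. -/
def meanSq (f : ℂ → N) (r : ℝ) : ℝ := Real.circleAverage (fun z => ‖f z‖ ^ 2) 0 r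

theorem hasSum_taylorCoeff {f : ℂ → N} (hf : DifferentiableOn ℂ f (Metric.ball 0 1)) {z : ℂ}
    (hz : z ∈ Metric.ball (0 : ℂ) 1) : HasSum (fun n => z ^ n • taylorCoeff f n) (f z) := by
  have h := Complex.hasSum_taylorSeries_on_ball hf hz
  convert h using 2 with n
  rw [taylorCoeff, sub_zero, smul_comm]

theorem summable_taylorCoeff {f : ℂ → N} (hf : DifferentiableOn ℂ f (Metric.ball 0 1)) {r : ℝ}
    (hr0 : 0 ≤ r) (hr : r < 1) : Summable (fun n => r ^ n * ‖taylorCoeff f n‖) := by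
  obtain ⟨s, hrs, hs⟩ := exists_between hr
  have hs0 : 0 < s := hr0.trans_lt hrs
  have h := hasSum_taylorCoeff hf (z := (s : ℂ)) (by simpa [abs_of_pos hs0] using hs)
  have ht := h.summable.tendsto_atTop_zero.norm
  obtain ⟨C, hC⟩ := ht.bddAbove_range
  have hC' : ∀ n, s ^ n * ‖taylorCoeff f n‖ ≤ C := fun n => by
    have := hC ⟨n, rfl⟩
    simpa [norm_smul, abs_of_pos hs0] using this
  refine Summable.of_nonneg_of_le (fun n => by positivity) (fun n => ?_)
    ((summable_geometric_of_lt_one (r := r / s) (by positivity)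
      ((div_lt_one hs0).2 hrs)).mul_left C)
  calc r ^ n * ‖taylorCoeff f n‖ = (s ^ n * ‖taylorCoeff f n‖) * (r / s) ^ n := by
        rw [div_pow]; field_simp
    _ ≤ C * (r / s) ^ n := by gcongr; exact hC' n

theorem circleAverage_taylorCoeff {f : ℂ → N} (hf : DifferentiableOn ℂ f (Metric.ball 0 1)) {r : ℝ}
    (hr0 : 0 < r) (hr : r < 1) (n : ℕ) :
    Real.circleAverage (fun z => (z ^ n)⁻¹ • f z) 0 r = taylorCoeff f n := by
  have h := DifferentiableOn.circleIntegral_one_div_sub_center_pow_smul hr0 n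
    (hf.mono (Metric.closedBall_subset_ball hr))
  rw [Real.circleAverage_eq_circleIntegral hr0.ne']
  have e : (fun z : ℂ => (z - 0)⁻¹ • (z ^ n)⁻¹ • f z) = fun z => (1 / (z - 0) ^ (n + 1)) • f z := by
    funext z
    rw [smul_smul, pow_succ, one_div, mul_inv_rev]; simp
  rw [e, h, smul_smul, taylorCoeff]
  congr 1
  have : (2 * Real.pi * Complex.I : ℂ) ≠ 0 := Complex.two_pi_I_ne_zero
  field_simp

theorem continuous_circle {f : ℂ → N} (hf : DifferentiableOn ℂ f (Metric.ball 0 1)) {r : ℝ}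
    (hr0 : 0 ≤ r) (hr : r < 1) : Continuous (fun t => f (circleMap 0 r t)) := by
  refine hf.continuousOn.comp_continuous (continuous_circleMap 0 r) (fun t => ?_)
  simpa [abs_of_nonneg hr0] using hr

/-- Parseval's identity on the circle of radius `r`. -/
theorem hasSum_meanSq {f : ℂ → N} (hf : DifferentiableOn ℂ f (Metric.ball 0 1)) {r : ℝ}
    (hr0 : 0 < r) (hr : r < 1) :
    HasSum (fun n => r ^ (2 * n) * ‖taylorCoeff f n‖ ^ 2) (meanSq f r) := by
  have hg := continuous_circle hf hr0.le hr
  have hzb : ∀ t, circleMap 0 r t ∈ Metric.ball (0 : ℂ) 1 := fun t => by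
    simpa [abs_of_pos hr0] using hr
  obtain ⟨M, hM⟩ : ∃ M, ∀ t, ‖f (circleMap 0 r t)‖ ≤ M := by
    obtain ⟨M, hM⟩ := (isCompact_sphere (0 : ℂ) r).exists_bound_of_continuousOn
      (hf.continuousOn.mono (Metric.sphere_subset_ball hr))
    exact ⟨M, fun t => hM _ (circleMap_mem_sphere 0 hr0.le t)⟩
  -- the expansion of the square norm, termwise
  let F : ℕ → ℝ → ℂ := fun n t =>
    ⟪(circleMap 0 r t) ^ n • taylorCoeff f n, f (circleMap 0 r t)⟫_ℂ
  have hs : HasSum (fun n => ∫ t in (0 : ℝ)..2 * Real.pi, F n t)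
      (∫ t in (0 : ℝ)..2 * Real.pi, ((‖f (circleMap 0 r t)‖ ^ 2 : ℝ) : ℂ)) := by
    refine intervalIntegral.hasSum_integral_of_dominated_convergence
      (fun n _ => r ^ n * ‖taylorCoeff f n‖ * M) (fun n => ?_) (fun n => ?_) ?_ ?_ ?_
    · refine Continuous.aestronglyMeasurable ?_
      exact Continuous.inner (((continuous_circleMap 0 r).pow n).smul continuous_const) hg
    · refine Filter.Eventually.of_forall fun t _ => ?_
      refine (norm_inner_le_norm _ _).trans ?_
      have : ‖(circleMap 0 r t) ^ n • taylorCoeff f n‖ = r ^ n * ‖taylorCoeff f n‖ := by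
        simp [norm_smul, abs_of_pos hr0]
      rw [this]
      gcongr
      exact hM t
    · exact Filter.Eventually.of_forall fun t _ =>
        (summable_taylorCoeff hf hr0.le hr).mul_right M
    · exact intervalIntegrable_const
    · refine Filter.Eventually.of_forall fun t _ => ?_
      have h1 := (hasSum_taylorCoeff hf (hzb t))
      have h2 := h1.mapL ((innerSLFlip ℂ) (f (circleMap 0 r t)))
      simpa [F, inner_self_eq_norm_sq_to_K, inner_smul_left, mul_comm] using h2
  have hterm : ∀ n, ∫ t in (0 : ℝ)..2 * Real.pi, F n t =
      ((2 * Real.pi * (r ^ (2 * n) * ‖taylorCoeff f n‖ ^ 2) : ℝ) : ℂ) := by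
    intro n
    have hne : ∀ t, circleMap 0 r t ≠ 0 := fun t => circleMap_ne_center hr0.ne'
    have hF : ∀ t, F n t = (r : ℂ) ^ (2 * n) *
        (innerSL ℂ (taylorCoeff f n)) ((circleMap 0 r t ^ n)⁻¹ • f (circleMap 0 r t)) := by
      intro t
      have hc : (starRingEnd ℂ) (circleMap 0 r t) * circleMap 0 r t = (r : ℂ) ^ 2 := by
        rw [mul_comm, Complex.mul_conj, Complex.normSq_eq_norm_sq]
        simp
      have hc' : (starRingEnd ℂ) (circleMap 0 r t) ^ n
          = (r : ℂ) ^ (2 * n) * (circleMap 0 r t ^ n)⁻¹ := by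
        rw [pow_mul, ← hc, mul_pow]
        field_simp [hne t]
      simp only [F, inner_smul_left, map_pow, innerSL_apply_apply, inner_smul_right, hc']
      ring
    simp_rw [hF]
    rw [intervalIntegral.integral_const_mul]
    have hi : IntervalIntegrable (fun t => (circleMap 0 r t ^ n)⁻¹ • f (circleMap 0 r t))
        MeasureTheory.volume 0 (2 * Real.pi) := by
      refine Continuous.intervalIntegrable ?_ _ _
      exact (((continuous_circleMap 0 r).pow n).inv₀ (fun t => pow_ne_zero _ (hne t))).smul hg
    rw [ContinuousLinearMap.intervalIntegral_comp_comm _ hi]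
    have hav := circleAverage_taylorCoeff hf hr0 hr n
    rw [Real.circleAverage, inv_smul_eq_iff₀ (by positivity)] at hav
    rw [hav, innerSL_apply_apply, ← Complex.coe_smul, inner_smul_right,
      inner_self_eq_norm_sq_to_K, show ∀ x : ℝ, (RCLike.ofReal x : ℂ) = (x : ℂ) from fun _ => rfl]
    push_cast
    ring
  simp_rw [hterm] at hs
  rw [intervalIntegral.integral_ofReal, Complex.hasSum_ofReal] at hs
  have := hs.mul_left (2 * Real.pi)⁻¹
  rw [meanSq, Real.circleAverage, smul_eq_mul]
  simpa only [inv_mul_cancel_left₀ Real.two_pi_pos.ne'] using this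

theorem taylorCoeff_zero (f : ℂ → N) : taylorCoeff f 0 = f 0 := by simp [taylorCoeff]

/-- Integral means are at most the sum of the squares of the coefficients. -/
theorem meanSq_le_tsum {f : ℂ → N} (hf : DifferentiableOn ℂ f (Metric.ball 0 1))
    (hs : Summable fun n => ‖taylorCoeff f n‖ ^ 2) {r : ℝ} (hr0 : 0 < r) (hr : r < 1) :
    meanSq f r ≤ ∑' n, ‖taylorCoeff f n‖ ^ 2 := by
  refine hasSum_le (fun n => ?_) (hasSum_meanSq hf hr0 hr) hs.hasSum
  exact mul_le_of_le_one_left (by positivity) (pow_le_one₀ hr0.le hr.le)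

/-- A bound on the integral means bounds the partial sums of squares of the coefficients. -/
theorem sum_sq_le {f : ℂ → N} (hf : DifferentiableOn ℂ f (Metric.ball 0 1)) {C : ℝ}
    (hC : ∀ r, 0 < r → r < 1 → meanSq f r ≤ C) (s : Finset ℕ) :
    ∑ n ∈ s, ‖taylorCoeff f n‖ ^ 2 ≤ C := by
  have hcont : Filter.Tendsto (fun r : ℝ => ∑ n ∈ s, r ^ (2 * n) * ‖taylorCoeff f n‖ ^ 2)
      (nhdsWithin 1 (Set.Iio 1)) (nhds (∑ n ∈ s, (1 : ℝ) ^ (2 * n) * ‖taylorCoeff f n‖ ^ 2)) := by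
    refine tendsto_nhdsWithin_of_tendsto_nhds (Continuous.tendsto ?_ 1)
    fun_prop
  simp only [one_pow, one_mul] at hcont
  refine le_of_tendsto hcont ?_
  filter_upwards [Ioo_mem_nhdsLT (show (0 : ℝ) < 1 by norm_num)] with r hr
  refine (sum_le_hasSum s (fun n _ => ?_) (hasSum_meanSq hf hr.1 hr.2)).trans (hC r hr.1 hr.2)
  have := hr.1
  positivity

theorem summable_sq {f : ℂ → N} (hf : DifferentiableOn ℂ f (Metric.ball 0 1)) {C : ℝ}
    (hC : ∀ r, 0 < r → r < 1 → meanSq f r ≤ C) : Summable fun n => ‖taylorCoeff f n‖ ^ 2 :=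
  summable_of_sum_le (fun _ => by positivity) (sum_sq_le hf hC)

/-- Power series with bounded coefficients: differentiability and coefficients. -/
theorem powerSeries_aux (a : ℕ → N) {C : ℝ} (hC : ∀ n, ‖a n‖ ≤ C) :
    ∃ f : ℂ → N, DifferentiableOn ℂ f (Metric.ball 0 1) ∧ (∀ z ∉ Metric.ball (0 : ℂ) 1, f z = 0) ∧
      ∀ n, taylorCoeff f n = a n := by
  let p : FormalMultilinearSeries ℂ ℂ N := fun n =>
    ContinuousMultilinearMap.mkPiRing ℂ (Fin n) (a n)
  have hrad : (1 : ENNReal) ≤ p.radius := by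
    have := p.le_radius_of_bound C (r := 1) (fun n => by simpa [p] using hC n)
    simpa using this
  have hp := (p.hasFPowerSeriesOnBall (lt_of_lt_of_le zero_lt_one hrad)).mono zero_lt_one hrad
  have hball : Metric.eball (0 : ℂ) 1 = Metric.ball 0 1 := by
    rw [← ENNReal.ofReal_one, Metric.eball_ofReal]
  have hd : DifferentiableOn ℂ p.sum (Metric.ball 0 1) := by
    have := hp.differentiableOn
    rwa [hball] at this
  classical
  refine ⟨fun z => if z ∈ Metric.ball (0 : ℂ) 1 then p.sum z else 0, ?_, ?_, ?_⟩
  · exact hd.congr fun z hz => by simp only [if_pos hz]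
  · exact fun z hz => by simp only [if_neg hz]
  · intro n
    have hev : (fun z => if z ∈ Metric.ball (0 : ℂ) 1 then p.sum z else 0) =ᶠ[nhds 0] p.sum := by
      filter_upwards [Metric.ball_mem_nhds (0 : ℂ) one_pos] with z hz
      simp only [if_pos hz]
    have h := hp.factorial_smul (1 : ℂ) n
    rw [taylorCoeff, hev.iteratedDeriv_eq, iteratedDeriv_eq_iteratedFDeriv]
    rw [← h]
    simp only [p, ContinuousMultilinearMap.mkPiRing_apply, Finset.prod_const_one, one_smul]
    rw [← Nat.cast_smul_eq_nsmul ℂ, smul_smul, inv_mul_cancel₀ (by exact_mod_cast n.factorial_ne_zero),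
      one_smul]

end Taylor

/-! ### The Hardy space -/

section Hardy

variable (N : Type*) [NormedAddCommGroup N] [InnerProductSpace ℂ N] [CompleteSpace N]

/-- The `N`-valued functions that are analytic on the open unit disc and whose integral means
`(2π)⁻¹ ∫ ‖f(r e^{it})‖² dt`, `0 < r < 1`, are bounded. Functions on the disc are represented by
functions on `ℂ` that vanish outside the disc. -/
def hardySubmodule : Submodule ℂ (ℂ → N) where
  carrier := {f | DifferentiableOn ℂ f (Metric.ball 0 1) ∧
    (∀ z ∉ Metric.ball (0 : ℂ) 1, f z = 0) ∧ ∃ C, ∀ r, 0 < r → r < 1 → meanSq f r ≤ C}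
  add_mem' := by
    rintro f g ⟨hf, hf0, C, hC⟩ ⟨hg, hg0, D, hD⟩
    refine ⟨hf.add hg, fun z hz => by simp [hf0 z hz, hg0 z hz], 2 * C + 2 * D, fun r hr0 hr => ?_⟩
    have cf := (continuous_circle hf hr0.le hr).norm.pow 2
    have cg := (continuous_circle hg hr0.le hr).norm.pow 2
    have cfg := (continuous_circle (hf.add hg) hr0.le hr).norm.pow 2
    have hf' : CircleIntegrable (fun z => ‖f z‖ ^ 2) 0 r := cf.intervalIntegrable _ _
    have hg' : CircleIntegrable (fun z => ‖g z‖ ^ 2) 0 r := cg.intervalIntegrable _ _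
    have hfg' : CircleIntegrable (fun z => ‖(f + g) z‖ ^ 2) 0 r := cfg.intervalIntegrable _ _
    have h1 : meanSq (f + g) r ≤
        Real.circleAverage (fun z => 2 * ‖f z‖ ^ 2 + 2 * ‖g z‖ ^ 2) 0 r := by
      refine Real.circleAverage_mono hfg' ?_ (fun z _ => ?_)
      · exact ((cf.const_mul 2).add (cg.const_mul 2)).intervalIntegrable _ _
      · have := norm_add_le (f z) (g z)
        have h0 := norm_nonneg (f z + g z)
        simp only [Pi.add_apply]
        nlinarith [sq_nonneg (‖f z‖ - ‖g z‖)]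
    have h2 : Real.circleAverage (fun z => 2 * ‖f z‖ ^ 2 + 2 * ‖g z‖ ^ 2) 0 r =
        2 * meanSq f r + 2 * meanSq g r := by
      have e1 := Real.circleAverage_fun_smul (a := (2 : ℝ)) (f := fun z => ‖f z‖ ^ 2) (c := 0) (R := r)
      have e2 := Real.circleAverage_fun_smul (a := (2 : ℝ)) (f := fun z => ‖g z‖ ^ 2) (c := 0) (R := r)
      simp only [smul_eq_mul] at e1 e2
      rw [Real.circleAverage_fun_add, e1, e2]
      · rfl
      · exact (cf.const_mul 2).intervalIntegrable _ _
      · exact (cg.const_mul 2).intervalIntegrable _ _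
    linarith [hC r hr0 hr, hD r hr0 hr]
  zero_mem' := ⟨differentiableOn_const 0, fun _ _ => rfl, 0, fun r _ _ => by
    simp [meanSq, Real.circleAverage]⟩
  smul_mem' := by
    rintro c f ⟨hf, hf0, C, hC⟩
    refine ⟨hf.const_smul c, fun z hz => by simp [hf0 z hz], ‖c‖ ^ 2 * C, fun r hr0 hr => ?_⟩
    have e : meanSq (c • f) r = ‖c‖ ^ 2 * meanSq f r := by
      rw [meanSq, meanSq, ← smul_eq_mul, ← Real.circleAverage_fun_smul]
      simp only [Pi.smul_apply, norm_smul, mul_pow, smul_eq_mul]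
    rw [e]
    gcongr
    exact hC r hr0 hr

/-- The Hardy space `H²_N` of `N`-valued analytic functions on the unit disc. -/
def Hardy : Type _ := hardySubmodule N

variable {N}

namespace Hardy

instance : AddCommGroup (Hardy N) := inferInstanceAs (AddCommGroup (hardySubmodule N))
instance : Module ℂ (Hardy N) := inferInstanceAs (Module ℂ (hardySubmodule N))
instance : FunLike (Hardy N) ℂ N := ⟨fun f => f.1, Subtype.val_injective⟩

theorem differentiableOn (f : Hardy N) : DifferentiableOn ℂ f (Metric.ball 0 1) := f.2.1

theorem apply_eq_zero (f : Hardy N) {z : ℂ} (hz : z ∉ Metric.ball (0 : ℂ) 1) : f z = 0 := f.2.2.1 z hz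

@[ext] theorem ext {f g : Hardy N} (h : ∀ z ∈ Metric.ball (0 : ℂ) 1, f z = g z) : f = g := by
  refine Subtype.ext (funext fun z => ?_)
  by_cases hz : z ∈ Metric.ball (0 : ℂ) 1
  · exact h z hz
  · exact (f.apply_eq_zero hz).trans (g.apply_eq_zero hz).symm

@[simp] theorem add_apply (f g : Hardy N) (z : ℂ) : (f + g) z = f z + g z := rfl
@[simp] theorem smul_apply (c : ℂ) (f : Hardy N) (z : ℂ) : (c • f) z = c • f z := rfl
@[simp] theorem zero_apply (z : ℂ) : (0 : Hardy N) z = 0 := rfl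

theorem summable_coeff (f : Hardy N) : Summable fun n => ‖taylorCoeff f n‖ ^ 2 :=
  f.2.2.2.elim fun _ hC => summable_sq f.differentiableOn hC

theorem memlp_coeff (f : Hardy N) : Memℓp (taylorCoeff f) 2 :=
  memℓp_gen (by simpa using f.summable_coeff)

theorem taylorCoeff_add (f g : Hardy N) (n : ℕ) :
    taylorCoeff (f + g : Hardy N) n = taylorCoeff f n + taylorCoeff g n := by
  have hf := (f.differentiableOn.analyticAt (Metric.ball_mem_nhds 0 one_pos)).contDiffAt (n := n)
  have hg := (g.differentiableOn.analyticAt (Metric.ball_mem_nhds 0 one_pos)).contDiffAt (n := n)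
  rw [taylorCoeff, taylorCoeff, taylorCoeff, ← smul_add]
  exact congrArg _ (iteratedDeriv_add hf hg)

theorem taylorCoeff_smul (c : ℂ) (f : Hardy N) (n : ℕ) :
    taylorCoeff (c • f : Hardy N) n = c • taylorCoeff f n := by
  rw [taylorCoeff, taylorCoeff, smul_comm c]
  exact congrArg _ (iteratedDeriv_const_smul_field (n := n) (x := 0) c (f : ℂ → N))

/-- The sequence of Taylor coefficients. -/
def coeffLin : Hardy N →ₗ[ℂ] lp (fun _ : ℕ => N) 2 where
  toFun f := ⟨taylorCoeff f, f.memlp_coeff⟩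
  map_add' f g := by
    ext n
    exact taylorCoeff_add f g n
  map_smul' c f := by
    ext n
    exact taylorCoeff_smul c f n

/-- The Taylor coefficients identify `H²_N` with the square summable sequences in `N`. -/
def coeffEquiv : Hardy N ≃ₗ[ℂ] lp (fun _ : ℕ => N) 2 :=
  LinearEquiv.ofBijective coeffLin
    (by
      constructor
      · intro f g h
        have h' : ∀ n, taylorCoeff f n = taylorCoeff g n := fun n =>
          congrFun (congrArg Subtype.val h) n
        refine Hardy.ext fun z hz => ?_
        refine (hasSum_taylorCoeff f.differentiableOn hz).unique ?_
        simp_rw [h']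
        exact hasSum_taylorCoeff g.differentiableOn hz
      · intro a
        obtain ⟨f, hd, h0, hc⟩ := powerSeries_aux a (fun n => lp.norm_apply_le_norm (by simp) a n)
        have hs : Summable fun n => ‖taylorCoeff f n‖ ^ 2 := by
          have := (lp.memℓp a).summable (by simp)
          simpa [hc] using this
        refine ⟨⟨f, hd, h0, _, fun r hr0 hr => meanSq_le_tsum hd hs hr0 hr⟩, ?_⟩
        ext n
        exact hc n)

@[simp] theorem coeffEquiv_apply (f : Hardy N) (n : ℕ) : coeffEquiv f n = taylorCoeff f n := rfl

/-- The norm is `‖f‖² = ∑ ‖f̂(n)‖²`, where `f̂(n)` are the Taylor coefficients. -/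
instance : NormedAddCommGroup (Hardy N) :=
  NormedAddCommGroup.induced (Hardy N) (lp (fun _ : ℕ => N) 2) coeffEquiv coeffEquiv.injective

/-- The inner product is `⟪f, g⟫ = ∑ ⟪f̂(n), ĝ(n)⟫`. -/
instance : InnerProductSpace ℂ (Hardy N) where
  __ := NormedSpace.induced ℂ (Hardy N) (lp (fun _ : ℕ => N) 2) coeffEquiv
  inner f g := ⟪coeffEquiv f, coeffEquiv g⟫_ℂ
  norm_sq_eq_re_inner f := norm_sq_eq_re_inner (coeffEquiv f)
  conj_inner_symm f g := inner_conj_symm (coeffEquiv f) (coeffEquiv g)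
  add_left f g h := by rw [map_add, inner_add_left]
  smul_left f g c := by rw [map_smul, inner_smul_left]

/-- The Taylor coefficients as a unitary map. -/
def coeffIsometry : Hardy N ≃ₗᵢ[ℂ] lp (fun _ : ℕ => N) 2 where
  toLinearEquiv := coeffEquiv
  norm_map' _ := rfl

instance : CompleteSpace (Hardy N) :=
  (completeSpace_congr (e := (coeffIsometry (N := N)).toEquiv)
    (coeffIsometry (N := N)).isometry.isUniformEmbedding).2 inferInstance

theorem inner_eq_tsum (f g : Hardy N) :
    ⟪f, g⟫_ℂ = ∑' n, ⟪taylorCoeff f n, taylorCoeff g n⟫_ℂ :=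
  lp.inner_eq_tsum (coeffEquiv f) (coeffEquiv g)

theorem norm_sq_eq_tsum (f : Hardy N) : ‖f‖ ^ 2 = ∑' n, ‖taylorCoeff f n‖ ^ 2 := by
  have h : ‖f‖ = ‖coeffEquiv f‖ := rfl
  have := lp.norm_rpow_eq_tsum (p := 2) (by simp) (coeffEquiv f)
  rw [h]
  simpa using this

/-- The norm is the usual Hardy space norm, `‖f‖² = sup_{r < 1} (2π)⁻¹ ∫ ‖f(r e^{it})‖² dt`. -/
theorem isLUB_norm_sq (f : Hardy N) : IsLUB (meanSq f '' Set.Ioo 0 1) (‖f‖ ^ 2) := by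
  rw [norm_sq_eq_tsum]
  constructor
  · rintro _ ⟨r, hr, rfl⟩
    exact meanSq_le_tsum f.differentiableOn f.summable_coeff hr.1 hr.2
  · intro C hC
    exact Summable.tsum_le_of_sum_le f.summable_coeff
      (sum_sq_le f.differentiableOn fun r hr0 hr => hC ⟨r, ⟨hr0, hr⟩, rfl⟩)

end Hardy

end Hardy

/-! ### The Neil algebra -/

section Algebra

/-- A function on the closed unit disc as a function on `ℂ`, extended by `0`. -/
def discExt (a : C(Metric.closedBall (0 : ℂ) 1, ℂ)) (z : ℂ) : ℂ :=
  open Classical in if h : z ∈ Metric.closedBall (0 : ℂ) 1 then a ⟨z, h⟩ else 0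

theorem discExt_of_mem (a : C(Metric.closedBall (0 : ℂ) 1, ℂ)) {z : ℂ}
    (h : z ∈ Metric.closedBall (0 : ℂ) 1) : discExt a z = a ⟨z, h⟩ := dif_pos h

theorem discExt_add (a b : C(Metric.closedBall (0 : ℂ) 1, ℂ)) :
    discExt (a + b) = discExt a + discExt b := by
  funext z; by_cases h : z ∈ Metric.closedBall (0 : ℂ) 1 <;> simp [discExt, h]

theorem discExt_mul (a b : C(Metric.closedBall (0 : ℂ) 1, ℂ)) :
    discExt (a * b) = discExt a * discExt b := by
  funext z; by_cases h : z ∈ Metric.closedBall (0 : ℂ) 1 <;> simp [discExt, h]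

theorem discExt_smul (c : ℂ) (a : C(Metric.closedBall (0 : ℂ) 1, ℂ)) :
    discExt (c • a) = c • discExt a := by
  funext z; by_cases h : z ∈ Metric.closedBall (0 : ℂ) 1 <;> simp [discExt, h]

theorem norm_discExt_le (a : C(Metric.closedBall (0 : ℂ) 1, ℂ)) (z : ℂ) : ‖discExt a z‖ ≤ ‖a‖ := by
  by_cases h : z ∈ Metric.closedBall (0 : ℂ) 1
  · rw [discExt_of_mem a h]; exact a.norm_coe_le_norm _
  · simp [discExt, h]

/-- The disc algebra: continuous functions on the closed unit disc, analytic in the open disc. -/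
def discAlgebra : Subalgebra ℂ C(Metric.closedBall (0 : ℂ) 1, ℂ) where
  carrier := {a | DifferentiableOn ℂ (discExt a) (Metric.ball 0 1)}
  add_mem' {a b} ha hb := by
    simp only [Set.mem_ofPred_eq, discExt_add] at *
    exact ha.add hb
  mul_mem' {a b} ha hb := by
    simp only [Set.mem_ofPred_eq, discExt_mul] at *
    exact ha.mul hb
  algebraMap_mem' c := by
    refine (differentiableOn_const c).congr fun z hz => ?_
    rw [discExt_of_mem _ (Metric.ball_subset_closedBall hz)]
    rfl

theorem discAlgebra_differentiableAt {a : C(Metric.closedBall (0 : ℂ) 1, ℂ)}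
    (ha : a ∈ discAlgebra) : DifferentiableAt ℂ (discExt a) 0 :=
  DifferentiableOn.differentiableAt ha (Metric.ball_mem_nhds 0 one_pos)

/-- The Neil algebra: the elements `a` of the disc algebra with `a'(0) = 0`. -/
def neilAlgebra : Subalgebra ℂ C(Metric.closedBall (0 : ℂ) 1, ℂ) where
  carrier := {a | a ∈ discAlgebra ∧ deriv (discExt a) 0 = 0}
  add_mem' := by
    rintro a b ⟨ha, ha'⟩ ⟨hb, hb'⟩
    refine ⟨add_mem ha hb, ?_⟩
    rw [discExt_add, deriv_add (discAlgebra_differentiableAt ha) (discAlgebra_differentiableAt hb),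
      ha', hb', add_zero]
  mul_mem' := by
    rintro a b ⟨ha, ha'⟩ ⟨hb, hb'⟩
    refine ⟨mul_mem ha hb, ?_⟩
    rw [discExt_mul, deriv_mul (discAlgebra_differentiableAt ha) (discAlgebra_differentiableAt hb),
      ha', hb', zero_mul, mul_zero, add_zero]
  algebraMap_mem' c := by
    refine ⟨algebraMap_mem _ c, ?_⟩
    have : discExt (algebraMap ℂ _ c) =ᶠ[nhds 0] fun _ => c := by
      filter_upwards [Metric.closedBall_mem_nhds (0 : ℂ) one_pos] with z hz
      rw [discExt_of_mem _ hz]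
      rfl
    rw [this.deriv_eq, deriv_const]

/-- The norm of a square matrix over the Neil algebra: the supremum over the open disc of the
operator norm (on Euclidean space) of the matrix of values. -/
def matrixNorm {n : ℕ} (F : Matrix (Fin n) (Fin n) neilAlgebra) : ℝ :=
  ⨆ z : Metric.ball (0 : ℂ) 1,
    ‖Matrix.toEuclideanCLM (𝕜 := ℂ) (F.map fun a => discExt (a : C(_, ℂ)) z)‖

end Algebra

/-! ### Representations of the Neil algebra -/

section Rep

variable {H : Type*} [NormedAddCommGroup H] [InnerProductSpace ℂ H]

/-- The operator `1_n ⊗ ρ (F)` on `H ⊕ ⋯ ⊕ H` (with `n` summands): the operator matrix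
`(ρ (F i j))`. -/
def amplify (ρ : neilAlgebra →ₙₐ[ℂ] (H →L[ℂ] H)) {n : ℕ} (F : Matrix (Fin n) (Fin n) neilAlgebra) :
    PiLp 2 (fun _ : Fin n => H) →L[ℂ] PiLp 2 (fun _ : Fin n => H) :=
  (PiLp.continuousLinearEquiv 2 ℂ (fun _ : Fin n => H)).symm.toContinuousLinearMap ∘L
    ContinuousLinearMap.pi fun i => ∑ j, ρ (F i j) ∘L PiLp.proj 2 (fun _ : Fin n => H) j

theorem amplify_apply (ρ : neilAlgebra →ₙₐ[ℂ] (H →L[ℂ] H)) {n : ℕ}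
    (F : Matrix (Fin n) (Fin n) neilAlgebra) (h : PiLp 2 (fun _ : Fin n => H)) (i : Fin n) :
    amplify ρ F h i = ∑ j, ρ (F i j) (h j) := by
  simp [amplify]

/-- A unital representation. -/
def IsUnital (ρ : neilAlgebra →ₙₐ[ℂ] (H →L[ℂ] H)) : Prop := ρ 1 = 1

/-- `‖1_n ⊗ ρ (F)‖ ≤ ‖F‖_n` for all `n` and all `n × n` matrices `F` over the algebra. -/
def IsCompletelyContractive (ρ : neilAlgebra →ₙₐ[ℂ] (H →L[ℂ] H)) : Prop :=
  ∀ (n : ℕ) (F : Matrix (Fin n) (Fin n) neilAlgebra), ‖amplify ρ F‖ ≤ matrixNorm F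

/-- Purity: the ranges of the operators `ρ a` have intersection `{0}`, where `a` runs through the
elements of the algebra without zeros on the unit circle. (Some restriction on `a` is needed, as
`a = 0` would make the intersection trivial. If a function vanishing at a point `λ` of the circle
were admitted, the character `a ↦ a(λ)`, which extends to a point evaluation on the continuous
functions on the circle, would count as pure.) -/
def IsPure (ρ : neilAlgebra →ₙₐ[ℂ] (H →L[ℂ] H)) : Prop :=
  ⋂ a ∈ {a : neilAlgebra | ∀ z : ℂ, ‖z‖ = 1 → discExt (a : C(_, ℂ)) z ≠ 0}, Set.range (ρ a) = {0}

/-- Extremality: every dilation `ρ` of `π` to a completely contractive representation extends `π`.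
The dilations are tested on the Hilbert spaces `K` of a universe `v`. -/
def IsExtremal.{v, u} {H : Type u} [NormedAddCommGroup H] [InnerProductSpace ℂ H] [CompleteSpace H]
    (π : neilAlgebra →ₙₐ[ℂ] (H →L[ℂ] H)) : Prop :=
  ∀ (K : Type v) [NormedAddCommGroup K] [InnerProductSpace ℂ K] [CompleteSpace K]
    (ρ : neilAlgebra →ₙₐ[ℂ] (K →L[ℂ] K)), IsCompletelyContractive ρ →
    ∀ V : H →ₗᵢ[ℂ] K,
      (∀ a, π a = V.toContinuousLinearMap.adjoint ∘L ρ a ∘L V.toContinuousLinearMap) →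
      ∀ a, V.toContinuousLinearMap ∘L π a = ρ a ∘L V.toContinuousLinearMap

/-- Unitary equivalence of representations. -/
def UnitarilyEquivalent {H' : Type*} [NormedAddCommGroup H'] [InnerProductSpace ℂ H']
    (ρ : neilAlgebra →ₙₐ[ℂ] (H →L[ℂ] H)) (σ : neilAlgebra →ₙₐ[ℂ] (H' →L[ℂ] H')) : Prop :=
  ∃ U : H ≃ₗᵢ[ℂ] H', ∀ a h, U (ρ a h) = σ a (U h)

end Rep

/-! ### The multiplication representations -/

section Multiplication

variable {N : Type*} [NormedAddCommGroup N] [InnerProductSpace ℂ N] [CompleteSpace N]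

theorem meanSq_mul_le {a : C(Metric.closedBall (0 : ℂ) 1, ℂ)} (ha : a ∈ discAlgebra) (f : Hardy N)
    {r : ℝ} (hr0 : 0 < r) (hr : r < 1) :
    meanSq (fun z => discExt a z • f z) r ≤ ‖a‖ ^ 2 * meanSq f r := by
  have hd : DifferentiableOn ℂ (fun z => discExt a z • f z) (Metric.ball 0 1) :=
    DifferentiableOn.smul ha f.differentiableOn
  have c1 := (continuous_circle hd hr0.le hr).norm.pow 2
  have c2 := (continuous_circle f.differentiableOn hr0.le hr).norm.pow 2
  rw [meanSq, meanSq, ← smul_eq_mul, ← Real.circleAverage_fun_smul]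
  refine Real.circleAverage_mono (c1.intervalIntegrable _ _)
    (Continuous.intervalIntegrable (c2.const_smul (‖a‖ ^ 2)) 0 (2 * Real.pi)) (fun z _ => ?_)
  simp only [norm_smul, mul_pow, smul_eq_mul]
  gcongr
  exact norm_discExt_le a z

/-- The product `a f` of an element `a` of the disc algebra and `f ∈ H²_N`. -/
def mulHardy {a : C(Metric.closedBall (0 : ℂ) 1, ℂ)} (ha : a ∈ discAlgebra) (f : Hardy N) :
    Hardy N :=
  ⟨fun z => discExt a z • f z, DifferentiableOn.smul ha f.differentiableOn,
    fun z hz => by simp only [f.apply_eq_zero hz, smul_zero], ‖a‖ ^ 2 * ‖f‖ ^ 2, fun r hr0 hr =>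
      (meanSq_mul_le ha f hr0 hr).trans (mul_le_mul_of_nonneg_left
        (f.isLUB_norm_sq.1 ⟨r, ⟨hr0, hr⟩, rfl⟩) (by positivity))⟩

theorem mulHardy_apply {a : C(Metric.closedBall (0 : ℂ) 1, ℂ)} (ha : a ∈ discAlgebra)
    (f : Hardy N) (z : ℂ) : mulHardy ha f z = discExt a z • f z := rfl

theorem norm_mulHardy_le {a : C(Metric.closedBall (0 : ℂ) 1, ℂ)} (ha : a ∈ discAlgebra)
    (f : Hardy N) : ‖mulHardy ha f‖ ≤ ‖a‖ * ‖f‖ := by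
  refine le_of_sq_le_sq ?_ (by positivity)
  rw [mul_pow]
  refine (mulHardy ha f).isLUB_norm_sq.2 ?_
  rintro _ ⟨r, hr, rfl⟩
  exact (meanSq_mul_le ha f hr.1 hr.2).trans (mul_le_mul_of_nonneg_left
        (f.isLUB_norm_sq.1 ⟨r, hr, rfl⟩) (by positivity))

/-- Multiplication by `a` as a bounded operator on `H²_N`. -/
def mulOp {a : C(Metric.closedBall (0 : ℂ) 1, ℂ)} (ha : a ∈ discAlgebra) : Hardy N →L[ℂ] Hardy N :=
  LinearMap.mkContinuous
    { toFun := mulHardy ha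
      map_add' := fun f g => Hardy.ext fun z _ => by simp [mulHardy_apply]
      map_smul' := fun c f => Hardy.ext fun z _ => by
        simp [mulHardy_apply, smul_comm c] } ‖a‖ (norm_mulHardy_le ha)

theorem mulOp_apply {a : C(Metric.closedBall (0 : ℂ) 1, ℂ)} (ha : a ∈ discAlgebra)
    (f : Hardy N) (z : ℂ) : mulOp ha f z = discExt a z • f z := rfl

variable (N) in
/-- The subspace `N ⊕ zN` of `H²_N`. -/
def linearPart : Submodule ℂ (Hardy N) where
  carrier := {f | ∃ c d : N, ∀ z ∈ Metric.ball (0 : ℂ) 1, f z = c + z • d}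
  add_mem' := by
    rintro f g ⟨c, d, h⟩ ⟨c', d', h'⟩
    refine ⟨c + c', d + d', fun z hz => ?_⟩
    rw [Hardy.add_apply, h z hz, h' z hz, smul_add]
    abel
  zero_mem' := ⟨0, 0, fun z _ => by simp⟩
  smul_mem' := by
    rintro k f ⟨c, d, h⟩
    refine ⟨k • c, k • d, fun z hz => ?_⟩
    rw [Hardy.smul_apply, h z hz, smul_add, smul_comm k]

theorem taylorCoeff_one (f : ℂ → N) : taylorCoeff f 1 = deriv f 0 := by
  simp [taylorCoeff, iteratedDeriv_one]

theorem taylorCoeff_of_mem_linearPart {f : Hardy N} (hf : f ∈ linearPart N) (n : ℕ) :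
    taylorCoeff f (n + 2) = 0 := by
  obtain ⟨c, d, h⟩ := hf
  have hev : (f : ℂ → N) =ᶠ[nhds 0] fun z => c + z • d := by
    filter_upwards [Metric.ball_mem_nhds (0 : ℂ) one_pos] with z hz using h z hz
  have h1 : deriv (fun z : ℂ => c + z • d) = fun _ => d := by
    funext z
    simpa using (((hasDerivAt_id z).smul_const d).const_add c).deriv
  rw [taylorCoeff, hev.iteratedDeriv_eq, iteratedDeriv_succ', h1, iteratedDeriv_succ', deriv_const']
  simp

/-- If `a` is in the Neil algebra and `v ∈ N ⊕ zN` then `⟪v, a f⟫ = a(0) ⟪v, f⟫`. -/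
theorem inner_mulOp {a : C(Metric.closedBall (0 : ℂ) 1, ℂ)} (ha : a ∈ neilAlgebra)
    {v : Hardy N} (hv : v ∈ linearPart N) (f : Hardy N) :
    ⟪v, mulOp ha.1 f⟫_ℂ = discExt a 0 * ⟪v, f⟫_ℂ := by
  have hz : ∀ g : Hardy N, ⟪v, g⟫_ℂ =
      ⟪taylorCoeff v 0, taylorCoeff g 0⟫_ℂ + ⟪taylorCoeff v 1, taylorCoeff g 1⟫_ℂ := by
    intro g
    rw [Hardy.inner_eq_tsum, tsum_eq_sum (s := Finset.range 2)]
    · simp [Finset.sum_range_succ]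
    · intro n hn
      obtain ⟨m, rfl⟩ : ∃ m, n = m + 2 := ⟨n - 2, by simp at hn; omega⟩
      rw [taylorCoeff_of_mem_linearPart hv, inner_zero_left]
  have h0 : taylorCoeff (mulOp ha.1 f) 0 = discExt a 0 • taylorCoeff f 0 := by
    rw [taylorCoeff_zero, taylorCoeff_zero, mulOp_apply]
  have h1 : taylorCoeff (mulOp ha.1 f) 1 = discExt a 0 • taylorCoeff f 1 := by
    rw [taylorCoeff_one, taylorCoeff_one]
    have hfd : DifferentiableAt ℂ f 0 :=
      f.differentiableOn.differentiableAt (Metric.ball_mem_nhds 0 one_pos)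
    have := deriv_smul (discAlgebra_differentiableAt ha.1) hfd
    rw [ha.2, zero_smul, add_zero] at this
    exact this
  rw [hz, hz f, h0, h1, inner_smul_right, inner_smul_right]
  ring

theorem mulOp_mem_orthogonal {a : C(Metric.closedBall (0 : ℂ) 1, ℂ)} (ha : a ∈ neilAlgebra)
    {V : Submodule ℂ (Hardy N)} (hV : V ≤ linearPart N) (f : Hardy N) (hf : f ∈ Vᗮ) :
    mulOp ha.1 f ∈ Vᗮ := by
  rw [Submodule.mem_orthogonal] at *
  intro v hv
  rw [inner_mulOp ha (hV hv), hf v hv, mul_zero]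

/-- The representation `π_V` of the Neil algebra on `H²_N ⊖ V`, for a subspace `V` of `N ⊕ zN`:
`π_V(a)` is multiplication by `a`. -/
def mulRep (V : Submodule ℂ (Hardy N)) (hV : V ≤ linearPart N) :
    neilAlgebra →ₙₐ[ℂ] (Vᗮ →L[ℂ] Vᗮ) where
  toFun a := (mulOp a.2.1).restrict (mulOp_mem_orthogonal a.2 hV)
  map_smul' c a := by
    ext f : 2
    refine Hardy.ext fun z _ => ?_
    change discExt (c • (a : C(_, ℂ))) z • (f : Hardy N) z
      = c • (discExt (a : C(_, ℂ)) z • (f : Hardy N) z)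
    rw [discExt_smul, Pi.smul_apply, smul_assoc]
  map_zero' := by
    ext f : 2
    refine Hardy.ext fun z _ => ?_
    change discExt 0 z • (f : Hardy N) z = 0
    simp [discExt]
  map_add' a b := by
    ext f : 2
    refine Hardy.ext fun z _ => ?_
    change discExt (a.1 + b.1) z • (f : Hardy N) z
      = discExt (a : C(_, ℂ)) z • (f : Hardy N) z + discExt (b : C(_, ℂ)) z • (f : Hardy N) z
    rw [discExt_add, Pi.add_apply, add_smul]
  map_mul' a b := by
    ext f : 2
    refine Hardy.ext fun z _ => ?_
    change discExt (a.1 * b.1) z • (f : Hardy N) z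
      = discExt (a : C(_, ℂ)) z • discExt (b : C(_, ℂ)) z • (f : Hardy N) z
    rw [discExt_mul, Pi.mul_apply, mul_smul]

/-- `π_V(a) f` is the pointwise product `a f`. -/
theorem mulRep_apply (V : Submodule ℂ (Hardy N)) (hV : V ≤ linearPart N) (a : neilAlgebra) (f : Vᗮ)
    (z : ℂ) : (mulRep V hV a f : Hardy N) z = discExt (a : C(_, ℂ)) z • (f : Hardy N) z := rfl

end Multiplication

end NeilRep

end

universe u v w

open scoped InnerProductSpace

noncomputable section

namespace NeilRep

/-! ### Values of matrices over the Neil algebra -/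

section MatrixValues

/-! Multiplication by a monomial is an isometry of `Hardy N`, and the span of the monomials `zⁿ`, `n
≠ 1`, is dense in the Neil algebra. This gives extremality of `mulRep`: if `π(zⁿ)` is an isometry
and is the compression of a contraction `ρ(zⁿ)`, then `Vπ(zⁿ)h` is the projection of `ρ(zⁿ)Vh` to
the range of `V` and is at least as long, so the two agree (`isExtremal_of_isometric`). Purity holds
because the range of `zⁿ` consists of functions vanishing to order `n` at `0`. Complete
contractivity is a pointwise matrix estimate integrated over circles of radius `r < 1`, followed by
`r → 1`.

For the converse, `ν` is dilated to a contractive representation `M` of the continuous functions on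
the circle (`IsCompletelyContractive.exists_dilation`). Being unital and completely contractive, `ν`
is completely positive. This is expressed as positivity of a real functional on functions on the
circle with values in quadratic forms on `H`. The M. Riesz extension theorem extends the functional,
and a GNS construction turns it into the dilation.

Extremality then upgrades the dilation to an intertwining, so `ν` becomes the restriction of `M` to
a closed subspace `X`. The operator `U = M(z)` is unitary, and `X` is invariant under `U²` and `U³`.
The closure `L` of `X + UX` is invariant under `U`, and `U²L ⊆ X ⊆ L`. The intersection `R` of the
spaces `UⁿL` reduces `U` and lies in `X`. Every `a` without zeros on the circle acts surjectively on
`R`, so purity forces `R = 0`. The Wold decomposition (`exists_wold`) identifies `L` with a Hardy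
space and `U` on `L` with multiplication by `z`. Then `X` becomes a closed subspace containing
`z²H²`, and its orthogonal complement lies in `N ⊕ zN`. -/

theorem continuousOn_discExt (a : C(Metric.closedBall (0 : ℂ) 1, ℂ)) :
    ContinuousOn (discExt a) (Metric.closedBall 0 1) := by
  rw [continuousOn_iff_continuous_domRestrict]
  refine a.continuous.congr fun z => ?_
  rw [Set.domRestrict_apply, discExt_of_mem a z.2]

theorem discExt_sum {ι : Type*} (s : Finset ι) (f : ι → C(Metric.closedBall (0 : ℂ) 1, ℂ)) (z : ℂ) :
    discExt (∑ i ∈ s, f i) z = ∑ i ∈ s, discExt (f i) z := by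
  by_cases h : z ∈ Metric.closedBall (0 : ℂ) 1 <;> simp [discExt, h, ContinuousMap.sum_apply]

theorem discExt_one {z : ℂ} (hz : z ∈ Metric.closedBall (0 : ℂ) 1) : discExt 1 z = 1 := by
  rw [discExt_of_mem _ hz]; rfl

variable {n : ℕ}

/-- The value at `z` of a matrix over the Neil algebra, as an operator on `ℂⁿ`. -/
def evalMatrix (F : Matrix (Fin n) (Fin n) neilAlgebra) (z : ℂ) :
    EuclideanSpace ℂ (Fin n) →L[ℂ] EuclideanSpace ℂ (Fin n) :=
  Matrix.toEuclideanCLM (𝕜 := ℂ) (F.map fun a => discExt (a : C(_, ℂ)) z)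

theorem evalMatrix_apply (F : Matrix (Fin n) (Fin n) neilAlgebra) (z : ℂ)
    (v : EuclideanSpace ℂ (Fin n)) (i : Fin n) :
    evalMatrix F z v i = ∑ j, discExt (F i j : C(_, ℂ)) z * v j := by
  rw [evalMatrix, Matrix.ofLp_toEuclideanCLM]
  simp [Matrix.mulVec, dotProduct]

/-- The coefficients are scalar functions and the matrix units are constant, so continuity and
analyticity of `evalMatrix` reduce to those of the entries. -/
theorem evalMatrix_eq_sum (F : Matrix (Fin n) (Fin n) neilAlgebra) (z : ℂ) :
    evalMatrix F z = ∑ i, ∑ j, discExt (F i j : C(_, ℂ)) z •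
      Matrix.toEuclideanCLM (𝕜 := ℂ) (Matrix.single i j 1) := by
  rw [evalMatrix, Matrix.matrix_eq_sum_single (F.map _)]
  simp only [map_sum, Matrix.map_apply, ← map_smul, Matrix.smul_single, smul_eq_mul, mul_one]

theorem continuousOn_evalMatrix (F : Matrix (Fin n) (Fin n) neilAlgebra) :
    ContinuousOn (evalMatrix F) (Metric.closedBall 0 1) := by
  refine ContinuousOn.congr (f := fun z => ∑ i, ∑ j, discExt (F i j : C(_, ℂ)) z •
      Matrix.toEuclideanCLM (𝕜 := ℂ) (Matrix.single i j 1)) ?_ (fun z _ => evalMatrix_eq_sum F z)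
  exact continuousOn_finsetSum _ fun i _ => continuousOn_finsetSum _ fun j _ =>
    (continuousOn_discExt _).smul continuousOn_const

theorem differentiableOn_evalMatrix (F : Matrix (Fin n) (Fin n) neilAlgebra) :
    DifferentiableOn ℂ (evalMatrix F) (Metric.ball 0 1) := by
  refine DifferentiableOn.congr (f := fun z => ∑ i, ∑ j, discExt (F i j : C(_, ℂ)) z •
      Matrix.toEuclideanCLM (𝕜 := ℂ) (Matrix.single i j 1)) ?_ (fun z _ => evalMatrix_eq_sum F z)
  exact DifferentiableOn.fun_sum fun i _ => DifferentiableOn.fun_sum fun j _ =>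
    DifferentiableOn.smul_const (F i j).2.1 _

theorem bddAbove_norm_evalMatrix (F : Matrix (Fin n) (Fin n) neilAlgebra) :
    BddAbove (Set.range fun z : Metric.ball (0 : ℂ) 1 => ‖evalMatrix F z‖) := by
  obtain ⟨C, hC⟩ := (isCompact_closedBall (0 : ℂ) 1).exists_bound_of_continuousOn
    (continuousOn_evalMatrix F)
  refine ⟨C, ?_⟩
  rintro _ ⟨z, rfl⟩
  exact hC z (Metric.ball_subset_closedBall z.2)

/-- `matrixNorm` is a supremum over the open disc only. Continuity carries the bound to the closed
disc, and so to the circle, where the dilation argument needs it. -/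
theorem norm_evalMatrix_le (F : Matrix (Fin n) (Fin n) neilAlgebra) {z : ℂ}
    (hz : z ∈ Metric.closedBall (0 : ℂ) 1) : ‖evalMatrix F z‖ ≤ matrixNorm F := by
  have hcl : closure (Metric.ball (0 : ℂ) 1) = Metric.closedBall 0 1 := closure_ball 0 one_ne_zero
  refine ContinuousWithinAt.closure_le (s := Metric.ball (0 : ℂ) 1) (by rwa [hcl])
    (((continuousOn_evalMatrix F).norm z hz).mono Metric.ball_subset_closedBall)
    continuousWithinAt_const fun w hw => ?_
  exact le_ciSup (bddAbove_norm_evalMatrix F) ⟨w, hw⟩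

theorem matrixNorm_nonneg (F : Matrix (Fin n) (Fin n) neilAlgebra) : 0 ≤ matrixNorm F :=
  Real.iSup_nonneg fun _ => norm_nonneg _

/-- The maximum principle for the norm of matrices over the Neil algebra. -/
theorem matrixNorm_le {F : Matrix (Fin n) (Fin n) neilAlgebra} {C : ℝ}
    (hC : ∀ z ∈ Metric.sphere (0 : ℂ) 1, ‖evalMatrix F z‖ ≤ C) : matrixNorm F ≤ C := by
  have : Nonempty (Metric.ball (0 : ℂ) 1) := ⟨⟨0, by simp⟩⟩
  refine ciSup_le fun z => ?_
  have hcl : closure (Metric.ball (0 : ℂ) 1) = Metric.closedBall 0 1 := closure_ball 0 one_ne_zero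
  refine Complex.norm_le_of_forall_mem_frontier_norm_le (f := evalMatrix F) Metric.isBounded_ball
    ⟨differentiableOn_evalMatrix F, by rw [hcl]; exact continuousOn_evalMatrix F⟩ ?_
    (subset_closure z.2)
  rwa [frontier_ball 0 one_ne_zero]

/-- The norm of a `1 × 1` matrix. -/
theorem matrixNorm_single_le (a : neilAlgebra) {C : ℝ} (hC0 : 0 ≤ C)
    (hC : ∀ z ∈ Metric.sphere (0 : ℂ) 1, ‖discExt (a : C(_, ℂ)) z‖ ≤ C) :
    matrixNorm (Matrix.of fun _ _ : Fin 1 => a) ≤ C := by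
  refine matrixNorm_le fun z hz => ContinuousLinearMap.opNorm_le_bound _ hC0 fun v => ?_
  rw [EuclideanSpace.norm_eq, EuclideanSpace.norm_eq, Fin.sum_univ_one, Fin.sum_univ_one,
    Real.sqrt_sq (norm_nonneg _), Real.sqrt_sq (norm_nonneg _), evalMatrix_apply, Fin.sum_univ_one,
    norm_mul]
  exact mul_le_mul_of_nonneg_right (hC z hz) (norm_nonneg _)

/-- This is the case of `1 × 1` matrices. By the maximum principle the function need only be bounded
on the circle. -/
theorem IsCompletelyContractive.norm_apply_le {H : Type*} [NormedAddCommGroup H]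
    [InnerProductSpace ℂ H] {ρ : neilAlgebra →ₙₐ[ℂ] (H →L[ℂ] H)} (hρ : IsCompletelyContractive ρ)
    (a : neilAlgebra) {C : ℝ} (hC0 : 0 ≤ C)
    (hC : ∀ z ∈ Metric.sphere (0 : ℂ) 1, ‖discExt (a : C(_, ℂ)) z‖ ≤ C) (h : H) :
    ‖ρ a h‖ ≤ C * ‖h‖ := by
  have h1 := (hρ 1 (Matrix.of fun _ _ => a)).trans (matrixNorm_single_le a hC0 hC)
  have h2 := (amplify ρ (Matrix.of fun _ _ : Fin 1 => a)).le_of_opNorm_le h1 (WithLp.toLp 2 fun _ => h)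
  simpa [PiLp.norm_eq_of_L2, amplify_apply, Real.sqrt_sq] using h2

theorem IsCompletelyContractive.opNorm_apply_le {H : Type*} [NormedAddCommGroup H]
    [InnerProductSpace ℂ H] {ρ : neilAlgebra →ₙₐ[ℂ] (H →L[ℂ] H)} (hρ : IsCompletelyContractive ρ)
    (a : neilAlgebra) : ‖ρ a‖ ≤ ‖a‖ :=
  ContinuousLinearMap.opNorm_le_bound _ (norm_nonneg _) fun h =>
    hρ.norm_apply_le a (norm_nonneg _) (fun z _ => norm_discExt_le _ z) h

theorem IsCompletelyContractive.continuous_apply {H : Type*} [NormedAddCommGroup H]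
    [InnerProductSpace ℂ H] {ρ : neilAlgebra →ₙₐ[ℂ] (H →L[ℂ] H)} (hρ : IsCompletelyContractive ρ)
    (h : H) : Continuous fun a => ρ a h :=
  (AddMonoidHomClass.continuous_of_bound
    ((ContinuousLinearMap.apply ℂ H h).toLinearMap.comp (ρ : neilAlgebra →ₗ[ℂ] (H →L[ℂ] H)))
    ‖h‖ fun a => by
      rw [mul_comm]
      exact (ρ a).le_of_opNorm_le (hρ.opNorm_apply_le a) h)

end MatrixValues

/-! ### Density of the polynomials -/

section Density

/-- The function `zⁿ` on the closed disc. -/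
def monomial (n : ℕ) : C(Metric.closedBall (0 : ℂ) 1, ℂ) := ⟨fun z => (z : ℂ) ^ n, by fun_prop⟩

theorem discExt_monomial (n : ℕ) {z : ℂ} (hz : z ∈ Metric.closedBall (0 : ℂ) 1) :
    discExt (monomial n) z = z ^ n := by
  rw [discExt_of_mem _ hz]; rfl

theorem monomial_mem_discAlgebra (n : ℕ) : monomial n ∈ discAlgebra :=
  (differentiable_pow n).differentiableOn.congr fun _ hz =>
    discExt_monomial n (Metric.ball_subset_closedBall hz)

theorem monomial_mem_neilAlgebra {n : ℕ} (hn : n ≠ 1) : monomial n ∈ neilAlgebra := by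
  refine ⟨monomial_mem_discAlgebra n, ?_⟩
  have : discExt (monomial n) =ᶠ[nhds 0] fun z => z ^ n := by
    filter_upwards [Metric.closedBall_mem_nhds (0 : ℂ) one_pos] with z hz
    exact discExt_monomial n hz
  rw [this.deriv_eq, deriv_pow_field]
  rcases Nat.lt_or_ge n 2 with h | h
  · interval_cases n
    · simp
    · exact absurd rfl hn
  · rw [zero_pow (by omega), mul_zero]

/-- The function `zⁿ`, `n ≠ 1`, as an element of the Neil algebra. -/
def neilMonomial {n : ℕ} (hn : n ≠ 1) : neilAlgebra := ⟨monomial n, monomial_mem_neilAlgebra hn⟩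

theorem exists_dilation_near (a : C(Metric.closedBall (0 : ℂ) 1, ℂ)) {ε : ℝ} (hε : 0 < ε) :
    ∃ r : ℝ, 0 ≤ r ∧ r < 1 ∧ ∀ z ∈ Metric.closedBall (0 : ℂ) 1,
      ‖discExt a z - discExt a (r * z)‖ < ε := by
  have hu := (isCompact_closedBall (0 : ℂ) 1).uniformContinuousOn_of_continuous
    (continuousOn_discExt a)
  obtain ⟨δ, hδ, h⟩ := Metric.uniformContinuousOn_iff.1 hu ε hε
  -- Then `|z - rz| ≤ 1 - r ≤ δ/2 < δ` on the closed disc; the maximum with `0` covers large `δ`.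
  refine ⟨max 0 (1 - δ / 2), le_max_left _ _, max_lt one_pos (by linarith), fun z hz => ?_⟩
  set r := max 0 (1 - δ / 2)
  have hr0 : 0 ≤ r := le_max_left _ _
  have hr1 : r < 1 := max_lt one_pos (by linarith)
  have hz' : ‖z‖ ≤ 1 := by simpa using hz
  rw [← dist_eq_norm]
  refine h z hz _ ?_ ?_
  · simp only [mem_closedBall_zero_iff, norm_mul, Complex.norm_real, Real.norm_eq_abs,
      abs_of_nonneg hr0]
    exact mul_le_one₀ hr1.le (norm_nonneg _) hz'
  · have : z - r * z = ((1 - r : ℝ) : ℂ) * z := by push_cast; ring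
    rw [dist_eq_norm, this, norm_mul, Complex.norm_real, Real.norm_eq_abs,
      abs_of_nonneg (by linarith)]
    calc (1 - r) * ‖z‖ ≤ (1 - r) * 1 := by gcongr
      _ ≤ δ / 2 := by linarith [le_max_right 0 (1 - δ / 2)]
      _ < δ := by linarith

/-- The polynomials without linear term are dense in the Neil algebra. -/
theorem dense_span_neilMonomial :
    Dense (Submodule.span ℂ {a : neilAlgebra | ∃ (n : ℕ) (hn : n ≠ 1), a = neilMonomial hn} :
      Set neilAlgebra) := by
  intro a
  refine Metric.mem_closure_iff.2 fun ε hε => ?_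
  -- The Taylor series of `z ↦ a(rz)` converges uniformly on the closed disc. The replacement of
  -- `a(z)` by `a(rz)` and the truncation of the series each cost less than `ε/4`.
  obtain ⟨r, hr0, hr1, hr⟩ := exists_dilation_near a.1 (half_pos (half_pos hε))
  set c := taylorCoeff (discExt a.1)
  have hc1 : c 1 = 0 := by
    have := a.2.2
    rwa [← taylorCoeff_one] at this
  have hs := summable_taylorCoeff (f := discExt a.1) a.2.1 hr0 hr1
  obtain ⟨m, hm⟩ := ((tendsto_sum_nat_add (fun n => r ^ n * ‖c n‖)).eventually
    (gt_mem_nhds (half_pos (half_pos hε)))).exists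
  -- The value `0` at `n = 1` is the correct term, since the linear coefficient of `a` is `a'(0) =
  -- 0`.
  let p : ℕ → neilAlgebra := fun n =>
    if hn : n = 1 then 0 else ((r : ℂ) ^ n * c n) • neilMonomial hn
  have hp : ∀ n, ∀ z ∈ Metric.closedBall (0 : ℂ) 1, discExt (p n).1 z = (r * z) ^ n * c n := by
    intro n z hz
    by_cases hn : n = 1
    · subst hn
      simp [p, hc1, discExt]
    · have : (p n).1 = ((r : ℂ) ^ n * c n) • monomial n := by simp only [p, dif_neg hn]; rfl
      rw [this, discExt_smul, Pi.smul_apply, discExt_monomial n hz, smul_eq_mul]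
      ring
  refine ⟨∑ n ∈ Finset.range m, p n, Submodule.sum_mem _ fun n _ => ?_, ?_⟩
  · by_cases hn : n = 1
    · simp only [p, dif_pos hn]; exact Submodule.zero_mem _
    · simp only [p, dif_neg hn]
      exact Submodule.smul_mem _ _ (Submodule.subset_span ⟨n, hn, rfl⟩)
  · rw [Subtype.dist_eq, dist_eq_norm]
    refine lt_of_le_of_lt ((ContinuousMap.norm_le _ (half_pos hε).le).2 fun z => ?_)
      (half_lt_self hε)
    have hz := z.2
    have hz' : ‖(z : ℂ)‖ ≤ 1 := mem_closedBall_zero_iff.1 hz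
    have hrz : (r * z : ℂ) ∈ Metric.ball (0 : ℂ) 1 := by
      rw [mem_ball_zero_iff, norm_mul, Complex.norm_real, Real.norm_eq_abs, abs_of_nonneg hr0]
      calc r * ‖(z : ℂ)‖ ≤ r * 1 := by gcongr
        _ < 1 := by linarith
    have hT := (hasSum_taylorCoeff (f := discExt a.1) a.2.1 hrz)
    have hev : (a.1 - (∑ n ∈ Finset.range m, p n : neilAlgebra).1) z
        = (discExt a.1 z - discExt a.1 (r * z))
          + (discExt a.1 (r * z) - ∑ n ∈ Finset.range m, (r * z : ℂ) ^ n * c n) := by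
      have : (∑ n ∈ Finset.range m, p n : neilAlgebra).1 z
          = ∑ n ∈ Finset.range m, (r * z : ℂ) ^ n * c n := by
        rw [AddSubmonoidClass.coe_finsetSum, ← discExt_of_mem _ hz, discExt_sum]
        exact Finset.sum_congr rfl fun n _ => hp n z hz
      rw [ContinuousMap.sub_apply, this, ← discExt_of_mem _ hz]
      ring
    rw [hev]
    have htail : ‖discExt a.1 (r * z) - ∑ n ∈ Finset.range m, (r * z : ℂ) ^ n * c n‖
        ≤ ∑' n, r ^ (n + m) * ‖c (n + m)‖ := by
      have h2 := (hasSum_nat_add_iff' m).2 hT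
      simp only [smul_eq_mul] at h2
      refine h2.norm_le_of_bounded ((summable_nat_add_iff m).2 hs).hasSum fun n => ?_
      rw [norm_mul, norm_pow, norm_mul, Complex.norm_real, Real.norm_eq_abs, abs_of_nonneg hr0]
      gcongr
      exact mul_le_of_le_one_right hr0 hz'
    have := hr z hz
    linarith [norm_add_le (discExt a.1 z - discExt a.1 (r * z))
      (discExt a.1 (r * z) - ∑ n ∈ Finset.range m, (r * z : ℂ) ^ n * c n)]

/-- Two continuous linear maps on the Neil algebra that agree on the monomials are equal. -/
theorem eq_of_eq_neilMonomial {E : Type*} [AddCommGroup E] [Module ℂ E] [TopologicalSpace E]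
    [T2Space E] {S T : neilAlgebra →ₗ[ℂ] E} (hS : Continuous S) (hT : Continuous T)
    (h : ∀ (n : ℕ) (hn : n ≠ 1), S (neilMonomial hn) = T (neilMonomial hn)) : S = T := by
  refine LinearMap.ext fun a => congrFun (Continuous.ext_on dense_span_neilMonomial hS hT ?_) a
  intro x hx
  refine LinearMap.eqOn_span (R := ℂ) (f := S) (g := T) ?_ hx
  rintro _ ⟨n, hn, rfl⟩
  exact h n hn

end Density

/-! ### Extremality from isometries -/

/-- A representation in which all monomials act isometrically is extremal. -/
theorem isExtremal_of_isometric {H : Type*} [NormedAddCommGroup H] [InnerProductSpace ℂ H]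
    [CompleteSpace H] {π : neilAlgebra →ₙₐ[ℂ] (H →L[ℂ] H)}
    (hπ : ∀ (n : ℕ) (hn : n ≠ 1) (h : H), ‖π (neilMonomial hn) h‖ = ‖h‖) : IsExtremal π := by
  intro K _ _ _ ρ hρ V hV a
  ext h
  have hadj : ∀ a x y, ⟪x, π a y⟫_ℂ = ⟪V x, ρ a (V y)⟫_ℂ := by
    intro a x y
    rw [hV a]
    exact ContinuousLinearMap.adjoint_inner_right V.toContinuousLinearMap x _
  -- No bound on `π` is assumed; continuity is inherited from `ρ` through the compression formula.
  have hcont : Continuous fun a => V (π a h) := by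
    have : (fun a => V (π a h)) =
        fun a => V (V.toContinuousLinearMap.adjoint (ρ a (V h))) := by
      funext a; rw [hV a]; rfl
    rw [this]
    exact V.continuous.comp (V.toContinuousLinearMap.adjoint.continuous.comp
      (hρ.continuous_apply (V h)))
  let S : neilAlgebra →ₗ[ℂ] K :=
    V.toLinearMap ∘ₗ (ContinuousLinearMap.apply ℂ H h).toLinearMap ∘ₗ
      (π : neilAlgebra →ₗ[ℂ] (H →L[ℂ] H))
  let T : neilAlgebra →ₗ[ℂ] K :=
    (ContinuousLinearMap.apply ℂ K (V h)).toLinearMap ∘ₗ (ρ : neilAlgebra →ₗ[ℂ] (K →L[ℂ] K))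
  have hST : S = T := by
    refine eq_of_eq_neilMonomial hcont (hρ.continuous_apply (V h)) fun n hn => ?_
    change V (π (neilMonomial hn) h) = ρ (neilMonomial hn) (V h)
    have h1 : ‖ρ (neilMonomial hn) (V h)‖ ≤ ‖h‖ := by
      have := hρ.norm_apply_le (neilMonomial hn) zero_le_one (fun z hz => by
        rw [neilMonomial, discExt_monomial n (Metric.sphere_subset_closedBall hz), norm_pow,
          mem_sphere_zero_iff_norm.1 hz, one_pow]) (V h)
      rwa [one_mul, V.norm_map] at this
    -- With `x = Vπ(zⁿ)h` and `y = ρ(zⁿ)Vh`, one has `Re ⟪x, y⟫ = ‖π(zⁿ)h‖² = ‖h‖²`, `‖x‖ = ‖h‖` and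
    -- `‖y‖ ≤ ‖h‖`. Expanding gives `‖x - y‖² ≤ 0`.
    have h2 : RCLike.re ⟪V (π (neilMonomial hn) h), ρ (neilMonomial hn) (V h)⟫_ℂ = ‖h‖ ^ 2 := by
      rw [← hadj, inner_self_eq_norm_sq, hπ]
    have h3 := norm_sub_sq (𝕜 := ℂ) (V (π (neilMonomial hn) h)) (ρ (neilMonomial hn) (V h))
    rw [h2, V.norm_map, hπ] at h3
    have h4 : ‖ρ (neilMonomial hn) (V h)‖ ^ 2 ≤ ‖h‖ ^ 2 := by gcongr
    have h5 : ‖V (π (neilMonomial hn) h) - ρ (neilMonomial hn) (V h)‖ ^ 2 ≤ 0 := by linarith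
    rw [← sub_eq_zero, ← norm_eq_zero]
    exact pow_eq_zero_iff two_ne_zero |>.1 (le_antisymm h5 (by positivity))
  exact LinearMap.congr_fun hST a

/-- A matrix acts on `Nⁿ` with the same bound as on `ℂⁿ`. -/
theorem sum_norm_sq_matrix_smul_le {N : Type*} [NormedAddCommGroup N]
    [InnerProductSpace ℂ N] {n : ℕ} {A : Fin n → Fin n → ℂ} {C : ℝ}
    (hA : ∀ v : Fin n → ℂ, ∑ i, ‖∑ j, A i j * v j‖ ^ 2 ≤ C * ∑ j, ‖v j‖ ^ 2) (x : Fin n → N) :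
    ∑ i, ‖∑ j, A i j • x j‖ ^ 2 ≤ C * ∑ j, ‖x j‖ ^ 2 := by
  -- In coordinates for an orthonormal basis of the finite-dimensional span, the claim splits into
  -- one scalar inequality for each basis vector.
  let S := Submodule.span ℂ (Set.range x)
  have : FiniteDimensional ℂ S := FiniteDimensional.span_of_finite ℂ (Set.finite_range x)
  let b := stdOrthonormalBasis ℂ S
  let y : Fin n → S := fun j => ⟨x j, Submodule.subset_span ⟨j, rfl⟩⟩
  have h1 : ∀ s : S, ‖(s : N)‖ ^ 2 = ∑ p, ‖⟪b p, s⟫_ℂ‖ ^ 2 := fun s =>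
    (b.sum_sq_norm_inner_right s).symm
  have h2 : ∀ i, ‖∑ j, A i j • x j‖ ^ 2 = ∑ p, ‖∑ j, A i j * ⟪b p, y j⟫_ℂ‖ ^ 2 := by
    intro i
    have : ∑ j, A i j • x j = ((∑ j, A i j • y j : S) : N) := by simp [y]
    rw [this, h1]
    simp_rw [inner_sum, inner_smul_right]
  have h3 : ∀ j, ‖x j‖ ^ 2 = ∑ p, ‖⟪b p, y j⟫_ℂ‖ ^ 2 := fun j => h1 (y j)
  simp_rw [h2, h3]
  rw [Finset.sum_comm, Finset.sum_comm (s := Finset.univ (α := Fin n)), Finset.mul_sum]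
  exact Finset.sum_le_sum fun p _ => hA _

/-! ### The multiplication representations -/

section Hardy

variable {N : Type*} [NormedAddCommGroup N] [InnerProductSpace ℂ N] [CompleteSpace N]

theorem mulOp_monomial_apply (k : ℕ) (f : Hardy N) {z : ℂ} (hz : z ∈ Metric.ball (0 : ℂ) 1) :
    mulOp (monomial_mem_discAlgebra k) f z = z ^ k • f z := by
  rw [mulOp_apply, discExt_monomial k (Metric.ball_subset_closedBall hz)]

/-- By Cauchy's formula both coefficients are averages over the circle of radius `1/2`, and the
integrands coincide: `z⁻⁽ⁿ⁺ᵏ⁾ zᵏ f = z⁻ⁿ f`. -/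
theorem taylorCoeff_mulOp_monomial_add (k n : ℕ) (f : Hardy N) :
    taylorCoeff (mulOp (monomial_mem_discAlgebra k) f) (n + k) = taylorCoeff f n := by
  have h0 : (0 : ℝ) < 1 / 2 := by norm_num
  have h1 : (1 / 2 : ℝ) < 1 := by norm_num
  rw [← circleAverage_taylorCoeff (Hardy.differentiableOn _) h0 h1,
    ← circleAverage_taylorCoeff f.differentiableOn h0 h1]
  refine Real.circleAverage_congr_sphere fun z hz => ?_
  rw [abs_of_pos h0, mem_sphere_zero_iff_norm] at hz
  have hz0 : z ≠ 0 := by rintro rfl; norm_num at hz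
  rw [mulOp_monomial_apply k f (by rw [mem_ball_zero_iff, hz]; exact h1), smul_smul, pow_add]
  congr 1
  field_simp

/-- The Cauchy integrand equals the one for the constant coefficient of `zᵏ⁻ⁿ f`, a function that
vanishes at `0`. -/
theorem taylorCoeff_mulOp_monomial_of_lt {k n : ℕ} (hn : n < k) (f : Hardy N) :
    taylorCoeff (mulOp (monomial_mem_discAlgebra k) f) n = 0 := by
  have h0 : (0 : ℝ) < 1 / 2 := by norm_num
  have h1 : (1 / 2 : ℝ) < 1 := by norm_num
  have h2 : taylorCoeff (mulOp (monomial_mem_discAlgebra (k - n)) f) 0 = 0 := by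
    rw [taylorCoeff_zero, mulOp_monomial_apply _ _ (by simp), zero_pow (by omega), zero_smul]
  rw [← h2, ← circleAverage_taylorCoeff (Hardy.differentiableOn _) h0 h1,
    ← circleAverage_taylorCoeff (Hardy.differentiableOn _) h0 h1]
  refine Real.circleAverage_congr_sphere fun z hz => ?_
  rw [abs_of_pos h0, mem_sphere_zero_iff_norm] at hz
  have hz0 : z ≠ 0 := by rintro rfl; norm_num at hz
  have hzb : z ∈ Metric.ball (0 : ℂ) 1 := by rw [mem_ball_zero_iff, hz]; exact h1
  rw [mulOp_monomial_apply k f hzb, mulOp_monomial_apply _ f hzb, smul_smul, smul_smul,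
    pow_sub₀ z hz0 hn.le]
  congr 1
  field_simp

theorem norm_mulOp_monomial (k : ℕ) (f : Hardy N) :
    ‖mulOp (monomial_mem_discAlgebra k) f‖ = ‖f‖ := by
  rw [← sq_eq_sq₀ (norm_nonneg _) (norm_nonneg _), Hardy.norm_sq_eq_tsum, Hardy.norm_sq_eq_tsum,
    ← (Hardy.summable_coeff _).sum_add_tsum_nat_add k, Finset.sum_eq_zero, zero_add]
  · simp_rw [taylorCoeff_mulOp_monomial_add]
  · intro n hn
    rw [taylorCoeff_mulOp_monomial_of_lt (Finset.mem_range.1 hn), norm_zero, sq, zero_mul]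

theorem Hardy.ext_taylorCoeff {f g : Hardy N} (h : ∀ n, taylorCoeff f n = taylorCoeff g n) :
    f = g := by
  refine Hardy.coeffEquiv.injective ?_
  ext n
  exact h n

/-- Dominated convergence in Parseval's identity. A limit, unlike a supremum, is compatible with the
finite sums of norms that occur for matrices. -/
theorem tendsto_meanSq (f : Hardy N) :
    Filter.Tendsto (meanSq f) (nhdsWithin 1 (Set.Iio 1)) (nhds (‖f‖ ^ 2)) := by
  rw [Hardy.norm_sq_eq_tsum]
  have hIoo : ∀ᶠ r in nhdsWithin (1 : ℝ) (Set.Iio 1), r ∈ Set.Ioo (0 : ℝ) 1 :=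
    Ioo_mem_nhdsLT zero_lt_one
  have h : Filter.Tendsto (fun r : ℝ => ∑' n, r ^ (2 * n) * ‖taylorCoeff f n‖ ^ 2)
      (nhdsWithin 1 (Set.Iio 1)) (nhds (∑' n, ‖taylorCoeff f n‖ ^ 2)) := by
    refine tendsto_tsum_of_dominated_convergence f.summable_coeff (fun n => ?_) ?_
    · have : Continuous fun r : ℝ => r ^ (2 * n) * ‖taylorCoeff f n‖ ^ 2 := by fun_prop
      have h1 := this.tendsto 1
      rw [one_pow, one_mul] at h1
      exact tendsto_nhdsWithin_of_tendsto_nhds h1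
    · filter_upwards [hIoo] with r hr n
      rw [Real.norm_of_nonneg (by have := hr.1; positivity)]
      exact mul_le_of_le_one_left (by positivity) (pow_le_one₀ hr.1.le hr.2.le)
  refine h.congr' ?_
  filter_upwards [hIoo] with r hr
  exact (hasSum_meanSq f.differentiableOn hr.1 hr.2).tsum_eq

theorem sum_norm_sq_evalMatrix_le {n : ℕ} (F : Matrix (Fin n) (Fin n) neilAlgebra) {z : ℂ}
    (hz : z ∈ Metric.closedBall (0 : ℂ) 1) (v : Fin n → ℂ) :
    ∑ i, ‖∑ j, discExt (F i j : C(_, ℂ)) z * v j‖ ^ 2 ≤ matrixNorm F ^ 2 * ∑ j, ‖v j‖ ^ 2 := by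
  have h := (evalMatrix F z).le_of_opNorm_le (norm_evalMatrix_le F hz) (WithLp.toLp 2 v)
  have h2 := pow_le_pow_left₀ (norm_nonneg _) h 2
  rw [mul_pow, EuclideanSpace.norm_sq_eq, EuclideanSpace.norm_sq_eq] at h2
  simpa only [evalMatrix_apply] using h2

/-- At each point of the circle of radius `r` this is the bound for a scalar matrix acting on `Nⁿ`.
It is averaged over the circle, and then `r → 1`. -/
theorem sum_norm_sq_sum_mulOp_le {n : ℕ} (F : Matrix (Fin n) (Fin n) neilAlgebra)
    (f : Fin n → Hardy N) :
    ∑ i, ‖∑ j, mulOp (F i j).2.1 (f j)‖ ^ 2 ≤ matrixNorm F ^ 2 * ∑ j, ‖f j‖ ^ 2 := by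
  refine le_of_tendsto_of_tendsto
    (tendsto_finsetSum _ fun i _ => tendsto_meanSq (∑ j, mulOp (F i j).2.1 (f j)))
    ((tendsto_finsetSum _ fun j _ => tendsto_meanSq (f j)).const_mul _) ?_
  filter_upwards [Ioo_mem_nhdsLT (zero_lt_one (α := ℝ))] with r hr
  have hc : ∀ g : Hardy N, CircleIntegrable (fun z => ‖g z‖ ^ 2) 0 r := fun g =>
    ((continuous_circle g.differentiableOn hr.1.le hr.2).norm.pow 2).intervalIntegrable _ _
  simp only [meanSq]
  rw [← Real.circleAverage_fun_sum fun i _ => hc _, ← Real.circleAverage_fun_sum fun i _ => hc _,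
    ← smul_eq_mul, ← Real.circleAverage_fun_smul]
  refine Real.circleAverage_mono (CircleIntegrable.fun_sum _ fun i _ => hc _)
    (CircleIntegrable.const_fun_smul (CircleIntegrable.fun_sum _ fun i _ => hc _))
    fun z hz => ?_
  rw [abs_of_pos hr.1, mem_sphere_zero_iff_norm] at hz
  have hzb : z ∈ Metric.closedBall (0 : ℂ) 1 := by
    rw [mem_closedBall_zero_iff, hz]; exact hr.2.le
  have happ : ∀ i, (∑ j, mulOp (F i j).2.1 (f j)) z
      = ∑ j, discExt (F i j : C(_, ℂ)) z • f j z := by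
    intro i
    let e : Hardy N →+ N := ⟨⟨fun g => g z, rfl⟩, fun _ _ => rfl⟩
    exact map_sum e _ _
  simp only [happ, smul_eq_mul]
  exact sum_norm_sq_matrix_smul_le (sum_norm_sq_evalMatrix_le F hzb) fun j => f j z

theorem mulRep_isUnital (V : Submodule ℂ (Hardy N)) (hV : V ≤ linearPart N) :
    IsUnital (mulRep V hV) := by
  refine ContinuousLinearMap.ext fun f => Subtype.ext (Hardy.ext fun z hz => ?_)
  rw [mulRep_apply]
  change discExt 1 z • _ = _
  rw [discExt_one (Metric.ball_subset_closedBall hz), one_smul]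
  rfl

theorem mulRep_isPure (V : Submodule ℂ (Hardy N)) (hV : V ≤ linearPart N) :
    IsPure (mulRep V hV) := by
  refine Set.eq_singleton_iff_unique_mem.2 ⟨?_, fun x hx => ?_⟩
  · exact Set.mem_iInter₂.2 fun a _ => ⟨0, map_zero _⟩
  · refine Subtype.ext (Hardy.ext_taylorCoeff fun n => ?_)
    -- The exponent `n + 2` exceeds `n`, so the range of the monomial has vanishing `n`-th
    -- coefficient, and it is never the forbidden exponent `1`.
    have hn : n + 2 ≠ 1 := by omega
    obtain ⟨y, rfl⟩ := Set.mem_iInter₂.1 hx (neilMonomial hn) fun z hz => by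
      rw [neilMonomial, discExt_monomial _ (by rw [mem_closedBall_zero_iff, hz])]
      exact pow_ne_zero _ (by rintro rfl; simp at hz)
    have h0 := taylorCoeff_mulOp_monomial_of_lt (k := n + 2) (n := n) (by omega) (0 : Hardy N)
    rw [map_zero] at h0
    exact (taylorCoeff_mulOp_monomial_of_lt (by omega) (y : Hardy N)).trans h0.symm

theorem mulRep_isCompletelyContractive (V : Submodule ℂ (Hardy N)) (hV : V ≤ linearPart N) :
    IsCompletelyContractive (mulRep V hV) := by
  intro n F
  refine ContinuousLinearMap.opNorm_le_bound _ (matrixNorm_nonneg F) fun h => ?_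
  refine le_of_sq_le_sq ?_ (mul_nonneg (matrixNorm_nonneg F) (norm_nonneg _))
  rw [mul_pow, PiLp.norm_sq_eq_of_L2, PiLp.norm_sq_eq_of_L2]
  have := sum_norm_sq_sum_mulOp_le F fun j => (h j : Hardy N)
  simp only [amplify_apply]
  refine (le_of_eq (Finset.sum_congr rfl fun i _ => ?_)).trans this
  rw [Submodule.coe_norm, AddSubmonoidClass.coe_finsetSum]
  rfl

theorem mulRep_isExtremal (V : Submodule ℂ (Hardy N)) (hV : V ≤ linearPart N) :
    IsExtremal (mulRep V hV) :=
  isExtremal_of_isometric fun n _ h => norm_mulOp_monomial n (h : Hardy N)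

end Hardy

/-! ### Positivity of completely contractive representations -/

section Positivity

variable {H : Type*} [NormedAddCommGroup H] [InnerProductSpace ℂ H]

/-- A unital completely contractive representation maps matrices with nonnegative real part on the
circle to operators with nonnegative real part. -/
theorem IsCompletelyContractive.re_inner_amplify_nonneg {ν : neilAlgebra →ₙₐ[ℂ] (H →L[ℂ] H)}
    (hν : IsCompletelyContractive ν) (h1 : IsUnital ν) {n : ℕ}
    {F : Matrix (Fin n) (Fin n) neilAlgebra}
    (hF : ∀ z ∈ Metric.sphere (0 : ℂ) 1, ∀ v, 0 ≤ RCLike.re ⟪v, evalMatrix F z v⟫_ℂ)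
    (x : PiLp 2 fun _ : Fin n => H) : 0 ≤ RCLike.re ⟪x, amplify ν F x⟫_ℂ := by
  set C := matrixNorm F
  -- Where `Re F ≥ 0` on the circle, `‖v - tFv‖² ≤ (1 + t²C²)‖v‖²`. Complete contractivity transfers
  -- this to `ν`; expanding, dividing by `t` and letting `t → 0` leaves the claim.
  have key : ∀ t : ℝ, 0 < t →
      -(t * (C ^ 2 * ‖x‖ ^ 2)) ≤ 2 * RCLike.re ⟪x, amplify ν F x⟫_ℂ := by
    intro t ht
    let G : Matrix (Fin n) (Fin n) neilAlgebra := 1 - (t : ℂ) • F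
    have hG : ∀ z ∈ Metric.closedBall (0 : ℂ) 1, ∀ v,
        evalMatrix G z v = v - (t : ℂ) • evalMatrix F z v := by
      intro z hz v
      have : (G.map fun a => discExt (a : C(_, ℂ)) z)
          = 1 - (t : ℂ) • F.map fun a => discExt (a : C(_, ℂ)) z := by
        ext i j
        have e : discExt ((G i j : neilAlgebra) : C(_, ℂ)) z =
            discExt (((1 : Matrix (Fin n) (Fin n) neilAlgebra) i j : neilAlgebra) : C(_, ℂ)) z
              - t * discExt (F i j : C(_, ℂ)) z := by
          simp only [discExt_of_mem _ hz]
          rfl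
        rw [Matrix.map_apply, e]
        by_cases hij : i = j
        · subst hij
          simp only [Matrix.sub_apply, Matrix.one_apply_eq, Matrix.smul_apply, Matrix.map_apply,
            smul_eq_mul]
          rw [show ((1 : neilAlgebra) : C(Metric.closedBall (0 : ℂ) 1, ℂ)) = 1 from rfl, discExt_one hz]
        · simp only [Matrix.sub_apply, Matrix.one_apply_ne hij, Matrix.smul_apply,
            Matrix.map_apply, smul_eq_mul]
          rw [show ((0 : neilAlgebra) : C(Metric.closedBall (0 : ℂ) 1, ℂ)) = 0 from rfl,
            discExt_of_mem _ hz]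
          rfl
      rw [evalMatrix, this, map_sub, map_one, map_smul]
      rfl
    have hGn : matrixNorm G ≤ Real.sqrt (1 + t ^ 2 * C ^ 2) := by
      refine matrixNorm_le fun z hz => ContinuousLinearMap.opNorm_le_bound _ (Real.sqrt_nonneg _)
        fun v => ?_
      have hzc := Metric.sphere_subset_closedBall hz
      refine le_of_sq_le_sq ?_ (by positivity)
      rw [mul_pow, Real.sq_sqrt (by positivity), hG z hzc, norm_sub_sq (𝕜 := ℂ), inner_smul_right,
        norm_smul, Complex.norm_real, Real.norm_of_nonneg ht.le]
      have e1 : RCLike.re ((t : ℂ) * ⟪v, evalMatrix F z v⟫_ℂ)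
          = t * RCLike.re ⟪v, evalMatrix F z v⟫_ℂ := by simp
      have e2 : ‖evalMatrix F z v‖ ≤ C * ‖v‖ :=
        (evalMatrix F z).le_of_opNorm_le (norm_evalMatrix_le F hzc) v
      have e3 := pow_le_pow_left₀ (norm_nonneg _) e2 2
      have e4 := mul_nonneg ht.le (hF z hz v)
      rw [e1]
      nlinarith [mul_le_mul_of_nonneg_left e3 (sq_nonneg t)]
    have hGx : amplify ν G x = x - (t : ℂ) • amplify ν F x := by
      ext i
      have e : ∀ j, ν (G i j) (x j) = (if i = j then x j else 0) - (t : ℂ) • ν (F i j) (x j) := by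
        intro j
        have e : G i j = (1 : Matrix (Fin n) (Fin n) neilAlgebra) i j - (t : ℂ) • F i j := rfl
        rw [e, map_sub, map_smul]
        by_cases hij : i = j
        · subst hij
          rw [Matrix.one_apply_eq, show ν 1 = 1 from h1, if_pos rfl]
          rfl
        · rw [Matrix.one_apply_ne hij, map_zero, if_neg hij]
          rfl
      rw [amplify_apply, PiLp.sub_apply, PiLp.smul_apply, amplify_apply]
      simp_rw [e]
      rw [Finset.sum_sub_distrib, Finset.sum_ite_eq, if_pos (Finset.mem_univ _), Finset.smul_sum]
    have h2 : ‖amplify ν G x‖ ≤ Real.sqrt (1 + t ^ 2 * C ^ 2) * ‖x‖ :=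
      (amplify ν G).le_of_opNorm_le ((hν n G).trans hGn) x
    have h3 := pow_le_pow_left₀ (norm_nonneg _) h2 2
    rw [mul_pow, Real.sq_sqrt (by positivity), hGx, norm_sub_sq (𝕜 := ℂ), inner_smul_right] at h3
    have e1 : RCLike.re ((t : ℂ) * ⟪x, amplify ν F x⟫_ℂ)
        = t * RCLike.re ⟪x, amplify ν F x⟫_ℂ := by simp
    rw [e1] at h3
    have h4 : t * -(t * (C ^ 2 * ‖x‖ ^ 2)) ≤ t * (2 * RCLike.re ⟪x, amplify ν F x⟫_ℂ) := by
      nlinarith [sq_nonneg ‖(t : ℂ) • amplify ν F x‖]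
    exact le_of_mul_le_mul_left h4 ht
  have hlim : Filter.Tendsto (fun t : ℝ => -(t * (C ^ 2 * ‖x‖ ^ 2)))
      (nhdsWithin 0 (Set.Ioi 0)) (nhds 0) := by
    have : Continuous fun t : ℝ => -(t * (C ^ 2 * ‖x‖ ^ 2)) := by fun_prop
    have h := this.tendsto 0
    rw [zero_mul, neg_zero] at h
    exact tendsto_nhdsWithin_of_tendsto_nhds h
  have := le_of_tendsto hlim (by filter_upwards [self_mem_nhdsWithin] with t ht using key t ht)
  linarith

/-- Complete positivity in terms of finite sums of vector functionals. -/
theorem IsCompletelyContractive.sum_re_inner_nonneg {ν : neilAlgebra →ₙₐ[ℂ] (H →L[ℂ] H)}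
    (hν : IsCompletelyContractive ν) (h1 : IsUnital ν) {ι : Type*} (s : Finset ι)
    (r : ι → ℝ) (a : ι → neilAlgebra) (h h' : ι → H)
    (hpos : ∀ z ∈ Metric.sphere (0 : ℂ) 1, ∀ k : H, 0 ≤ ∑ i ∈ s,
      r i * (⟪h i, k⟫_ℂ * (discExt (a i : C(_, ℂ)) z * ⟪k, h' i⟫_ℂ)).re) :
    0 ≤ ∑ i ∈ s, r i * (⟪h i, ν (a i) (h' i)⟫_ℂ).re := by
  classical
  let E := Submodule.span ℂ ((s.image h ∪ s.image h' : Finset H) : Set H)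
  have : FiniteDimensional ℂ E := FiniteDimensional.span_finset ℂ _
  let b := stdOrthonormalBasis ℂ E
  have hexp : ∀ y ∈ E, y = ∑ p, ⟪(b p : H), y⟫_ℂ • (b p : H) := by
    intro y hy
    have := congrArg (fun e : E => (e : H)) (b.sum_repr' ⟨y, hy⟩)
    simpa using this.symm
  have hh : ∀ i ∈ s, h i ∈ E := fun i hi => Submodule.subset_span
    (Finset.mem_coe.2 (Finset.mem_union_left _ (Finset.mem_image_of_mem _ hi)))
  have hh' : ∀ i ∈ s, h' i ∈ E := fun i hi => Submodule.subset_span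
    (Finset.mem_coe.2 (Finset.mem_union_right _ (Finset.mem_image_of_mem _ hi)))
  -- The matrix is chosen so that pairing `ν(F)` with the tuple of basis vectors `b` reproduces the
  -- sum of vector functionals.
  let F : Matrix (Fin (Module.finrank ℂ E)) (Fin (Module.finrank ℂ E)) neilAlgebra :=
    Matrix.of fun q p => ∑ i ∈ s, ((r i : ℂ) * (⟪h i, (b q : H)⟫_ℂ * ⟪(b p : H), h' i⟫_ℂ)) • a i
  have hx := hν.re_inner_amplify_nonneg h1 (F := F) (fun z hz v => ?_)
    (WithLp.toLp 2 fun p => (b p : H))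
  · have hl : ∀ i ∈ s, ∀ y : H, ⟪h i, y⟫_ℂ = ∑ q, ⟪h i, (b q : H)⟫_ℂ * ⟪(b q : H), y⟫_ℂ := by
      intro i hi y
      conv_lhs => rw [hexp _ (hh i hi)]
      simp_rw [sum_inner, inner_smul_left, inner_conj_symm]
    have hr : ∀ i ∈ s, ν (a i) (h' i) = ∑ p, ⟪(b p : H), h' i⟫_ℂ • ν (a i) (b p : H) := by
      intro i hi
      conv_lhs => rw [hexp _ (hh' i hi)]
      simp_rw [map_sum, map_smul]
    have e : ∑ i ∈ s, (r i : ℂ) * ⟪h i, ν (a i) (h' i)⟫_ℂ =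
        ⟪WithLp.toLp 2 fun p => (b p : H), amplify ν F (WithLp.toLp 2 fun p => (b p : H))⟫_ℂ := by
      rw [PiLp.inner_apply]
      simp only [amplify_apply, F, Matrix.of_apply, map_sum, map_smul,
        sum_apply, smul_apply, inner_sum, inner_smul_right]
      rw [Finset.sum_congr rfl fun q _ => Finset.sum_comm, Finset.sum_comm]
      refine Finset.sum_congr rfl fun i hi => ?_
      rw [hl i hi, Finset.mul_sum]
      refine Finset.sum_congr rfl fun q _ => ?_
      rw [hr i hi, inner_sum, Finset.mul_sum, Finset.mul_sum]
      refine Finset.sum_congr rfl fun p _ => ?_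
      rw [inner_smul_right]
      ring
    rw [← e] at hx
    simpa using hx
  · let k : H := ∑ p, (starRingEnd ℂ) (v p) • (b p : H)
    have hk := hpos z hz k
    have e : ⟪v, evalMatrix F z v⟫_ℂ =
        ∑ i ∈ s, (r i : ℂ) * (⟪h i, k⟫_ℂ * (discExt (a i : C(_, ℂ)) z * ⟪k, h' i⟫_ℂ)) := by
      rw [PiLp.inner_apply]
      simp only [evalMatrix_apply, F, Matrix.of_apply, AddSubmonoidClass.coe_finsetSum, discExt_sum,
        SetLike.val_smul, discExt_smul, Pi.smul_apply, smul_eq_mul, k, inner_sum, sum_inner,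
        inner_smul_left, inner_smul_right, RCLike.inner_apply, Finset.sum_mul, Finset.mul_sum,
        Complex.conj_conj]
      rw [Finset.sum_congr rfl fun q _ => Finset.sum_comm, Finset.sum_comm]
      refine Finset.sum_congr rfl fun i hi => ?_
      rw [Finset.sum_comm]
      refine Finset.sum_congr rfl fun q _ => Finset.sum_congr rfl fun p _ => ?_
      ring
    rw [e]
    simpa using hk

end Positivity

/-! ### Extension of positive functionals -/

section Extension

/-- A functional that is positive with respect to a cone extends to a functional on the whole space
that is positive on the part of the cone that is dominated by the original domain. -/
theorem exists_positive_extension {Z D : Type*} [AddCommGroup Z] [Module ℝ Z] [AddCommGroup D]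
    [Module ℝ D] (P : PointedCone ℝ Z) (Λ : D →ₗ[ℝ] Z) (s : D →ₗ[ℝ] ℝ)
    (hs : ∀ d, Λ d ∈ P → 0 ≤ s d) :
    ∃ g : Z →ₗ[ℝ] ℝ, (∀ d, g (Λ d) = s d) ∧ ∀ y ∈ P, (∃ d, Λ d - y ∈ P) → 0 ≤ g y := by
  obtain ⟨s', hs'⟩ : ∃ s' : Z →ₗ[ℝ] ℝ, ∀ d, s' (Λ d) = s d := by
    -- If `Λ d = 0`, then both `d` and `-d` satisfy the positivity condition, so `s d = 0` and `s`
    -- factors through `Λ`.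
    have : s ∈ Λ.ker.dualAnnihilator := by
      rw [Submodule.mem_dualAnnihilator]
      intro d hd
      rw [LinearMap.mem_ker] at hd
      refine le_antisymm ?_ (hs d (by rw [hd]; exact P.zero_mem))
      have := hs (-d) (by rw [map_neg, hd, neg_zero]; exact P.zero_mem)
      rw [map_neg] at this
      linarith
    rw [← LinearMap.range_dualMap_eq_dualAnnihilator_ker] at this
    obtain ⟨s', rfl⟩ := this
    exact ⟨s', fun d => rfl⟩
  -- The Riesz theorem requires every vector to be dominated by the initial domain, so it is applied
  -- on the subspace of vectors bounded on both sides by the range of `Λ`.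
  let E : Submodule ℝ Z :=
    { carrier := {y | (∃ d, Λ d + y ∈ P) ∧ ∃ d, Λ d - y ∈ P}
      add_mem' := by
        rintro y y' ⟨⟨d, hd⟩, e, he⟩ ⟨⟨d', hd'⟩, e', he'⟩
        refine ⟨⟨d + d', ?_⟩, e + e', ?_⟩
        · have := P.add_mem hd hd'
          rwa [add_add_add_comm, ← map_add] at this
        · have := P.add_mem he he'
          rwa [sub_add_sub_comm, ← map_add] at this
      zero_mem' := ⟨⟨0, by simp⟩, 0, by simp⟩
      smul_mem' := by
        have aux : ∀ (c : ℝ), 0 ≤ c → ∀ y d, Λ d + y ∈ P → Λ (c • d) + c • y ∈ P := by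
          intro c hc y d hd
          rw [map_smul, ← smul_add]
          exact PointedCone.smul_mem P hc hd
        rintro c y ⟨⟨d, hd⟩, e, he⟩
        rw [sub_eq_add_neg] at he
        rcases le_total 0 c with hc | hc
        · refine ⟨⟨_, aux c hc y d hd⟩, c • e, ?_⟩
          rw [sub_eq_add_neg, ← smul_neg]
          exact aux c hc _ e he
        · refine ⟨⟨-c • e, ?_⟩, -c • d, ?_⟩
          · have := aux (-c) (by linarith) _ e he
            rwa [smul_neg, ← neg_smul, neg_neg] at this
          · have := aux (-c) (by linarith) _ d hd
            rwa [neg_smul c y, ← sub_eq_add_neg] at this }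
  have hΛE : ∀ d, Λ d ∈ E := fun d => ⟨⟨-d, by simp⟩, d, by simp⟩
  obtain ⟨g, hg, hgP⟩ := riesz_extension (P.comap E.subtype)
    ⟨(LinearMap.range Λ).comap E.subtype, (s' ∘ₗ E.subtype).domRestrict _⟩
    (by
      rintro ⟨⟨y, hy⟩, d, hd⟩ hP
      change 0 ≤ s' y
      change Λ d = y at hd
      subst hd
      rw [hs']
      exact hs d hP)
    (by
      rintro ⟨y, ⟨d, hd⟩, hy⟩
      exact ⟨⟨⟨Λ d, hΛE d⟩, d, rfl⟩, hd⟩)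
  -- Outside `E` no positivity is claimed, and any linear extension serves.
  obtain ⟨g', rfl⟩ := LinearMap.exists_extend g
  refine ⟨g', fun d => ?_, fun y hy hd => hgP ⟨y, ⟨0, by simpa using hy⟩, hd⟩ hy⟩
  exact (hg ⟨⟨Λ d, hΛE d⟩, d, rfl⟩).trans (hs' d)

end Extension

/-! ### Positive functionals on operator valued functions on the circle -/

section States

variable {H : Type*} [NormedAddCommGroup H] [InnerProductSpace ℂ H]

/-- The unit circle. -/
abbrev unitSphere : Set ℂ := Metric.sphere 0 1

/-- Restriction of functions in the Neil algebra to the circle. -/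
def restrictSphere : neilAlgebra →ₐ[ℂ] C(unitSphere, ℂ) :=
  (ContinuousMap.compRightAlgHom ℂ ℂ
    ⟨Set.inclusion Metric.sphere_subset_closedBall, continuous_inclusion _⟩).comp neilAlgebra.val

theorem restrictSphere_apply (a : neilAlgebra) (z : unitSphere) :
    restrictSphere a z = discExt (a : C(_, ℂ)) z :=
  (discExt_of_mem _ (Metric.sphere_subset_closedBall z.2)).symm

/-- The quadratic form `k ↦ Re ⟪f, k⟫ ⟪k, f'⟫`, the real part of the operator of rank one given by
`f` and `f'`, as a function on the circle. -/
def rankOne (f f' : unitSphere → H) : unitSphere → H → ℝ :=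
  fun z k => (⟪f z, k⟫_ℂ * ⟪k, f' z⟫_ℂ).re

theorem rankOne_self_apply (f : unitSphere → H) (z : unitSphere) (k : H) :
    rankOne f f z k = ‖⟪k, f z⟫_ℂ‖ ^ 2 := by
  rw [rankOne, ← inner_conj_symm, mul_comm, Complex.mul_conj, Complex.ofReal_re,
    Complex.normSq_eq_norm_sq]

theorem rankOne_add_right (f f' f'' : unitSphere → H) :
    rankOne f (f' + f'') = rankOne f f' + rankOne f f'' := by
  ext z k
  simp [rankOne, mul_add]

theorem rankOne_smul_right (f f' : unitSphere → H) (r : ℝ) :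
    rankOne f ((r : ℂ) • f') = r • rankOne f f' := by
  ext z k
  simp only [rankOne, Pi.smul_apply, inner_smul_right, smul_eq_mul, mul_left_comm (_ : ℂ) (r : ℂ),
    Complex.re_ofReal_mul]

theorem rankOne_comm (f f' : unitSphere → H) : rankOne f f' = rankOne f' f := by
  ext z k
  rw [rankOne, rankOne, ← inner_conj_symm, ← inner_conj_symm k (f' z), ← map_mul, Complex.conj_re,
    mul_comm]

theorem rankOne_smul_smul (f f' : unitSphere → H) (c : ℂ) :
    rankOne (c • f) f' = rankOne f ((starRingEnd ℂ) c • f') := by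
  ext z k
  simp only [rankOne, Pi.smul_apply, inner_smul_right, inner_smul_left]
  ring_nf

variable (H) in
/-- A functional on quadratic form valued functions on the circle that is positive on the functions
dominated by sums of squares of elements of a module over the continuous functions. -/
structure PositiveState where
  domain : Submodule ℂ (unitSphere → H)
  -- The functional is defined on all real functions, with no continuity in `z` and no quadratic
  -- dependence on `k`; the only constraint is `nonneg`.
  functional : (unitSphere → H → ℝ) →ₗ[ℝ] ℝ
  mul_mem : ∀ (c : C(unitSphere, ℂ)) {f}, f ∈ domain → (fun z => c z • f z) ∈ domain
  nonneg : ∀ {y}, 0 ≤ y → ∀ {n : ℕ} (f : Fin n → domain),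
    y ≤ ∑ i, rankOne (f i : unitSphere → H) (f i) → 0 ≤ functional y

/-- A unital completely contractive representation is given by a positive state. -/
theorem IsCompletelyContractive.exists_positiveState {ν : neilAlgebra →ₙₐ[ℂ] (H →L[ℂ] H)}
    (hν : IsCompletelyContractive ν) (h1 : IsUnital ν) :
    ∃ φ : PositiveState H, (∀ h : H, Function.const unitSphere h ∈ φ.domain) ∧
      ∀ a h h', φ.functional (rankOne (Function.const unitSphere h)
        (fun z => restrictSphere a z • h')) = (⟪h, ν a h'⟫_ℂ).re := by
  let Λ : (neilAlgebra × H × H →₀ ℝ) →ₗ[ℝ] (unitSphere → H → ℝ) := Finsupp.linearCombination ℝ fun p =>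
    rankOne (Function.const unitSphere p.2.1) (fun z => restrictSphere p.1 z • p.2.2)
  let s : (neilAlgebra × H × H →₀ ℝ) →ₗ[ℝ] ℝ := Finsupp.linearCombination ℝ fun p => (⟪p.2.1, ν p.1 p.2.2⟫_ℂ).re
  -- Complete positivity of `ν`, tested on the circle.
  have hs : ∀ d, Λ d ∈ PointedCone.positive ℝ (unitSphere → H → ℝ) → 0 ≤ s d := by
    intro d hd
    rw [PointedCone.mem_positive] at hd
    refine hν.sum_re_inner_nonneg h1 d.support d (fun p => p.1) (fun p => p.2.1) (fun p => p.2.2)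
      fun z hz k => ?_
    have := hd ⟨z, hz⟩ k
    simp only [Λ, Finsupp.linearCombination_apply, Finsupp.sum, Finset.sum_apply, Pi.smul_apply,
      rankOne, Function.const_apply, inner_smul_right, restrictSphere_apply, smul_eq_mul,
      Pi.zero_apply] at this
    exact this
  obtain ⟨g, hg, hpos⟩ := exists_positive_extension _ Λ s hs
  -- The functions whose square is dominated by the range of `Λ`, so that positivity of `g` applies
  -- to them. Closure under sums uses `|α + β|² ≤ 2|α|² + 2|β|²`.
  let W : Submodule ℂ (unitSphere → H) :=
    { carrier := {f | ∃ d, rankOne f f ≤ Λ d}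
      add_mem' := by
        rintro f f' ⟨d, hd⟩ ⟨d', hd'⟩
        refine ⟨(2 : ℝ) • (d + d'), fun z k => ?_⟩
        rw [map_smul, map_add]
        have e1 := hd z k
        have e2 := hd' z k
        rw [rankOne_self_apply] at e1 e2 ⊢
        simp only [Pi.add_apply, inner_add_right, Pi.smul_apply, smul_eq_mul]
        have e3 := norm_add_le ⟪k, f z⟫_ℂ ⟪k, f' z⟫_ℂ
        have e4 := pow_le_pow_left₀ (norm_nonneg _) e3 2
        nlinarith [sq_nonneg (‖⟪k, f z⟫_ℂ‖ - ‖⟪k, f' z⟫_ℂ‖)]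
      zero_mem' := ⟨0, fun z k => by simp [rankOne]⟩
      smul_mem' := by
        rintro c f ⟨d, hd⟩
        refine ⟨(‖c‖ ^ 2) • d, fun z k => ?_⟩
        have e1 := hd z k
        rw [rankOne_self_apply] at e1 ⊢
        rw [map_smul, Pi.smul_apply, Pi.smul_apply, Pi.smul_apply, inner_smul_right, norm_mul,
          mul_pow]
        exact mul_le_mul_of_nonneg_left e1 (by positivity) }
  have hΛ : ∀ p, Λ (Finsupp.single p 1)
      = rankOne (Function.const unitSphere p.2.1) (fun z => restrictSphere p.1 z • p.2.2) := by
    intro p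
    simp only [Λ, Finsupp.linearCombination_single, one_smul]
  refine ⟨⟨W, g, ?_, ?_⟩, fun h => ?_, fun a h h' => ?_⟩
  · rintro c f ⟨d, hd⟩
    refine ⟨(‖c‖ ^ 2) • d, fun z k => ?_⟩
    have e1 := hd z k
    rw [rankOne_self_apply] at e1 ⊢
    rw [map_smul, Pi.smul_apply, Pi.smul_apply, inner_smul_right, norm_mul, mul_pow]
    have := c.norm_coe_le_norm z
    exact mul_le_mul (by gcongr) e1 (by positivity) (by positivity)
  · intro y hy n f hf
    choose d hd using fun i => (f i).2
    refine hpos y hy ⟨∑ i, d i, ?_⟩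
    rw [PointedCone.mem_positive, sub_nonneg, map_sum]
    exact hf.trans (Finset.sum_le_sum fun i _ => hd i)
  · refine ⟨Finsupp.single (1, h, h) 1, le_of_eq ?_⟩
    rw [hΛ, map_one]
    congr 1
    funext z
    simp
  · change g _ = _
    rw [← hΛ (a, h, h'), hg]
    simp only [s, Finsupp.linearCombination_single, one_smul]

end States

/-! ### The Gelfand–Naimark–Segal construction -/

section GNS

variable {H : Type*} [NormedAddCommGroup H] [InnerProductSpace ℂ H]

namespace PositiveState

variable (φ : PositiveState H)

/-- The domain of a positive state, with the semi-inner product given by the state. -/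
def PreGNS : Type _ := φ.domain

instance : AddCommGroup φ.PreGNS := inferInstanceAs (AddCommGroup φ.domain)
instance : Module ℂ φ.PreGNS := inferInstanceAs (Module ℂ φ.domain)

/-- The underlying function. -/
def toFn : φ.PreGNS →ₗ[ℂ] (unitSphere → H) := φ.domain.subtype

theorem functional_rankOne_self_nonneg (f : φ.PreGNS) :
    0 ≤ φ.functional (rankOne (φ.toFn f) (φ.toFn f)) :=
  φ.nonneg (fun z k => by rw [rankOne_self_apply]; exact sq_nonneg _) (fun _ : Fin 1 => f)
    (by rw [Fin.sum_univ_one]; rfl)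

/-- Moving `i` to the other slot conjugates it. This gives the Hermitian symmetry of the imaginary
part of `sesq`. -/
theorem functional_rankOne_I (f f' : unitSphere → H) :
    φ.functional (rankOne (Complex.I • f) f') = - φ.functional (rankOne f (Complex.I • f')) := by
  have : (-Complex.I) • f' = (((-1 : ℝ) : ℂ)) • (Complex.I • f') := by
    rw [smul_smul]; simp
  rw [rankOne_smul_smul, Complex.conj_I, this, rankOne_smul_right, map_smul, smul_eq_mul,
    neg_one_mul]

/-- The complex sesquilinear form whose real part is given by the state. -/
def sesq (f f' : unitSphere → H) : ℂ :=
  -- Linearity in the second variable forces `Im ⟪f, f'⟫ = -Re ⟪f, if'⟫`.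
  ⟨φ.functional (rankOne f f'), - φ.functional (rankOne f (Complex.I • f'))⟩

theorem sesq_add_right (f f' f'' : unitSphere → H) :
    φ.sesq f (f' + f'') = φ.sesq f f' + φ.sesq f f'' := by
  apply Complex.ext
  · simp [sesq, rankOne_add_right]
  · simp [sesq, rankOne_add_right, smul_add, add_comm]

theorem sesq_smul_right (f f' : unitSphere → H) (c : ℂ) :
    φ.sesq f (c • f') = c * φ.sesq f f' := by
  have e : ∀ c : ℂ, φ.functional (rankOne f (c • f')) =
      c.re * φ.functional (rankOne f f') + c.im * φ.functional (rankOne f (Complex.I • f')) := by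
    intro c
    have : c • f' = (c.re : ℂ) • f' + (c.im : ℂ) • (Complex.I • f') := by
      rw [smul_smul, ← add_smul, Complex.re_add_im]
    rw [this, rankOne_add_right, rankOne_smul_right, rankOne_smul_right, map_add, map_smul,
      map_smul, smul_eq_mul, smul_eq_mul]
  apply Complex.ext
  · simp [sesq, e c]
  · simp only [sesq, smul_smul, e (Complex.I * c), Complex.mul_im, Complex.mul_re, Complex.I_re,
      Complex.I_im]
    ring

theorem sesq_conj_symm (f f' : unitSphere → H) :
    (starRingEnd ℂ) (φ.sesq f' f) = φ.sesq f f' := by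
  apply Complex.ext
  · simp [sesq, rankOne_comm f']
  · simp [sesq, rankOne_comm f', functional_rankOne_I]

/-- The semi-inner product of the GNS construction. -/
@[reducible]
def gnsCore : PreInnerProductSpace.Core ℂ φ.PreGNS where
  inner f f' := φ.sesq (φ.toFn f) (φ.toFn f')
  conj_inner_symm f f' := φ.sesq_conj_symm _ _
  re_inner_nonneg f := φ.functional_rankOne_self_nonneg f
  add_left f f' f'' := by
    rw [map_add, ← sesq_conj_symm, sesq_add_right, map_add, sesq_conj_symm, sesq_conj_symm]
  smul_left f f' c := by
    rw [map_smul, ← sesq_conj_symm, sesq_smul_right, map_mul, sesq_conj_symm]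

instance : SeminormedAddCommGroup φ.PreGNS :=
  @InnerProductSpace.Core.toSeminormedAddCommGroup ℂ φ.PreGNS _ _ _ φ.gnsCore

instance : InnerProductSpace ℂ φ.PreGNS := InnerProductSpace.ofCore φ.gnsCore

theorem inner_def (f f' : φ.PreGNS) : ⟪f, f'⟫_ℂ = φ.sesq (φ.toFn f) (φ.toFn f') := rfl

theorem norm_sq_eq (f : φ.PreGNS) :
    ‖f‖ ^ 2 = φ.functional (rankOne (φ.toFn f) (φ.toFn f)) := by
  rw [@norm_sq_eq_re_inner ℂ]; rfl

/-- Pointwise inequalities between sums of squares give norm inequalities. -/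
theorem sum_norm_sq_le {n : ℕ} (f f' : Fin n → φ.PreGNS)
    (h : ∀ z k, ∑ i, ‖⟪k, φ.toFn (f i) z⟫_ℂ‖ ^ 2 ≤ ∑ i, ‖⟪k, φ.toFn (f' i) z⟫_ℂ‖ ^ 2) :
    ∑ i, ‖f i‖ ^ 2 ≤ ∑ i, ‖f' i‖ ^ 2 := by
  simp_rw [norm_sq_eq, ← map_sum]
  rw [← sub_nonneg, ← map_sub]
  -- The difference of the two sums is nonnegative and dominated by the sum for `f'`, as `nonneg`
  -- demands.
  refine φ.nonneg (fun z k => ?_) f' (fun z k => ?_)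
  · simp only [Pi.sub_apply, Finset.sum_apply, rankOne_self_apply, Pi.zero_apply, sub_nonneg]
    exact h z k
  · simp only [Pi.sub_apply, Finset.sum_apply, rankOne_self_apply]
    exact sub_le_self _ (Finset.sum_nonneg fun i _ => sq_nonneg _)

/-- Multiplication by a continuous function. -/
def mulFn (c : C(unitSphere, ℂ)) : φ.PreGNS →ₗ[ℂ] φ.PreGNS where
  toFun f := ⟨fun z => c z • φ.toFn f z, φ.mul_mem c f.2⟩
  map_add' f f' := Subtype.ext (funext fun z => smul_add (c z) (φ.toFn f z) (φ.toFn f' z))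
  map_smul' r f := Subtype.ext (funext fun z => smul_comm (c z) r (φ.toFn f z))

theorem toFn_mulFn (c : C(unitSphere, ℂ)) (f : φ.PreGNS) (z : unitSphere) :
    φ.toFn (φ.mulFn c f) z = c z • φ.toFn f z := rfl

theorem toFn_injective : Function.Injective φ.toFn := Subtype.val_injective

theorem norm_mulFn_le (c : C(unitSphere, ℂ)) (f : φ.PreGNS) : ‖φ.mulFn c f‖ ≤ ‖c‖ * ‖f‖ := by
  have h := φ.sum_norm_sq_le (n := 1) (fun _ => φ.mulFn c f) (fun _ => ((‖c‖ : ℝ) : ℂ) • f)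
    fun z k => by
      simp only [Fin.sum_univ_one, toFn_mulFn, map_smul, Pi.smul_apply, inner_smul_right, norm_mul,
        Complex.norm_real, norm_norm]
      gcongr
      exact c.norm_coe_le_norm z
  simp only [Fin.sum_univ_one, norm_smul, Complex.norm_real, norm_norm] at h
  exact le_of_sq_le_sq h (by positivity)

/-- Multiplication by a continuous function as a bounded operator. -/
def mulL (c : C(unitSphere, ℂ)) : φ.PreGNS →L[ℂ] φ.PreGNS :=
  (φ.mulFn c).mkContinuous ‖c‖ (φ.norm_mulFn_le c)

/-- The Hilbert space of the GNS construction. -/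
abbrev GNS : Type _ := UniformSpace.Completion φ.PreGNS

theorem gns_ext {S T : φ.GNS →L[ℂ] φ.GNS} (h : ∀ f : φ.PreGNS, S f = T f) : S = T :=
  ContinuousLinearMap.ext fun x =>
    congrFun (UniformSpace.Completion.ext S.continuous T.continuous h) x

/-- The multiplication representation of the continuous functions on the GNS space. -/
def gnsRep : C(unitSphere, ℂ) →ₐ[ℂ] (φ.GNS →L[ℂ] φ.GNS) :=
  AlgHom.ofLinearMap
    { toFun := fun c => (φ.mulL c).completion
      map_add' := fun c c' => φ.gns_ext fun f => by
        have : φ.mulL (c + c') f = φ.mulL c f + φ.mulL c' f :=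
          φ.toFn_injective (funext fun z => add_smul _ _ _)
        simp [this, UniformSpace.Completion.coe_add]
      map_smul' := fun r c => φ.gns_ext fun f => by
        have : φ.mulL (r • c) f = r • φ.mulL c f :=
          φ.toFn_injective (funext fun z => smul_assoc r (c z) (φ.toFn f z))
        simp [this, UniformSpace.Completion.coe_smul] }
    (φ.gns_ext fun f => by
        have : φ.mulL 1 f = f := φ.toFn_injective (funext fun z => one_smul _ _)
        simp [this])
    (fun c c' => φ.gns_ext fun f => by
        have : φ.mulL (c * c') f = φ.mulL c (φ.mulL c' f) :=
          φ.toFn_injective (funext fun z => mul_smul _ _ _)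
        simp [this])

theorem gnsRep_coe (c : C(unitSphere, ℂ)) (f : φ.PreGNS) :
    φ.gnsRep c (f : φ.GNS) = (φ.mulFn c f : φ.GNS) :=
  ContinuousLinearMap.completion_apply_coe (φ.mulL c) f

theorem norm_gnsRep_le (c : C(unitSphere, ℂ)) (x : φ.GNS) : ‖φ.gnsRep c x‖ ≤ ‖c‖ * ‖x‖ := by
  induction x using UniformSpace.Completion.induction_on with
  | hp => exact isClosed_le (φ.gnsRep c).continuous.norm (continuous_norm.const_mul _)
  | ih f =>
    rw [gnsRep_coe, UniformSpace.Completion.norm_coe, UniformSpace.Completion.norm_coe]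
    exact φ.norm_mulFn_le c f

/-- The restriction of the multiplication representation to the Neil algebra. -/
def gnsNeilRep : neilAlgebra →ₙₐ[ℂ] (φ.GNS →L[ℂ] φ.GNS) :=
  ((φ.gnsRep.comp restrictSphere : neilAlgebra →ₐ[ℂ] (φ.GNS →L[ℂ] φ.GNS)) :
    neilAlgebra →ₙₐ[ℂ] (φ.GNS →L[ℂ] φ.GNS))

theorem gnsNeilRep_apply (a : neilAlgebra) : φ.gnsNeilRep a = φ.gnsRep (restrictSphere a) := rfl

/-- On the dense subspace, `F(z)` acts on the scalar vectors `(⟪k, f_j(z)⟫)_j` with norm at most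
`matrixNorm F`. `sum_norm_sq_le` turns this pointwise inequality into one of norms. -/
theorem sum_norm_sq_gnsNeilRep_le {n : ℕ} (F : Matrix (Fin n) (Fin n) neilAlgebra)
    (x : Fin n → φ.GNS) :
    ∑ i, ‖∑ j, φ.gnsNeilRep (F i j) (x j)‖ ^ 2 ≤ matrixNorm F ^ 2 * ∑ j, ‖x j‖ ^ 2 := by
  have hdense : DenseRange (Pi.map fun (_ : Fin n) (f : φ.PreGNS) => (f : φ.GNS)) :=
    DenseRange.piMap fun _ => UniformSpace.Completion.denseRange_coe
  refine isClosed_property hdense (p := fun x : Fin n → φ.GNS =>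
    ∑ i, ‖∑ j, φ.gnsNeilRep (F i j) (x j)‖ ^ 2 ≤ matrixNorm F ^ 2 * ∑ j, ‖x j‖ ^ 2)
    (isClosed_le (by fun_prop) (by fun_prop)) (fun f => ?_) x
  have e : ∀ i, ∑ j, φ.gnsNeilRep (F i j) (f j : φ.GNS)
      = ((∑ j, φ.mulFn (restrictSphere (F i j)) (f j) : φ.PreGNS) : φ.GNS) := by
    intro i
    refine Eq.trans ?_ (map_sum (UniformSpace.Completion.toComplₗᵢ (𝕜 := ℂ) (E := φ.PreGNS)) _ _).symm
    exact Finset.sum_congr rfl fun j _ => φ.gnsRep_coe _ _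
  simp only [Pi.map_apply, e, UniformSpace.Completion.norm_coe]
  have h := φ.sum_norm_sq_le (fun i => ∑ j, φ.mulFn (restrictSphere (F i j)) (f j))
    (fun j => ((matrixNorm F : ℝ) : ℂ) • f j) fun z k => by
      have := sum_norm_sq_evalMatrix_le F (Metric.sphere_subset_closedBall z.2)
        fun j => ⟪k, φ.toFn (f j) z⟫_ℂ
      simp only [map_sum, Finset.sum_apply, toFn_mulFn, restrictSphere_apply, map_smul,
        Pi.smul_apply, inner_smul_right, inner_sum, norm_mul, Complex.norm_real,
        Real.norm_of_nonneg (matrixNorm_nonneg F), mul_pow, ← Finset.mul_sum]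
      simpa only [norm_mul, mul_pow] using this
  simpa only [norm_smul, Complex.norm_real, Real.norm_of_nonneg (matrixNorm_nonneg F), mul_pow,
    ← Finset.mul_sum] using h

theorem gnsNeilRep_isCompletelyContractive : IsCompletelyContractive φ.gnsNeilRep := by
  intro n F
  refine ContinuousLinearMap.opNorm_le_bound _ (matrixNorm_nonneg F) fun x => ?_
  refine le_of_sq_le_sq ?_ (mul_nonneg (matrixNorm_nonneg F) (norm_nonneg _))
  rw [mul_pow, PiLp.norm_sq_eq_of_L2, PiLp.norm_sq_eq_of_L2]
  simp only [amplify_apply]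
  exact φ.sum_norm_sq_gnsNeilRep_le F x

end PositiveState

/-- Dilation theorem: a unital completely contractive representation of the Neil algebra is the
compression of a representation of the continuous functions on the circle. -/
theorem IsCompletelyContractive.exists_dilation {H : Type w} [NormedAddCommGroup H]
    [InnerProductSpace ℂ H] [CompleteSpace H] {ν : neilAlgebra →ₙₐ[ℂ] (H →L[ℂ] H)}
    (hν : IsCompletelyContractive ν) (h1 : IsUnital ν) :
    ∃ (K : Type w) (_ : NormedAddCommGroup K) (_ : InnerProductSpace ℂ K) (_ : CompleteSpace K)
      (M : C(unitSphere, ℂ) →ₐ[ℂ] (K →L[ℂ] K)) (ρ : neilAlgebra →ₙₐ[ℂ] (K →L[ℂ] K))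
      (V : H →ₗᵢ[ℂ] K),
      (∀ c x, ‖M c x‖ ≤ ‖c‖ * ‖x‖) ∧ (∀ a, ρ a = M (restrictSphere a)) ∧
      IsCompletelyContractive ρ ∧
      ∀ a, ν a = V.toContinuousLinearMap.adjoint ∘L ρ a ∘L V.toContinuousLinearMap := by
  obtain ⟨φ, hc, hφ⟩ := hν.exists_positiveState h1
  let V₀ : H →ₗ[ℂ] φ.PreGNS :=
    { toFun := fun h => ⟨Function.const unitSphere h, hc h⟩
      map_add' := fun _ _ => rfl
      map_smul' := fun _ _ => rfl }
  have hinner : ∀ a h h', ⟪V₀ h, φ.mulFn (restrictSphere a) (V₀ h')⟫_ℂ = ⟪h, ν a h'⟫_ℂ := by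
    intro a h h'
    rw [PositiveState.inner_def]
    apply Complex.ext
    · exact hφ a h h'
    -- The state only gives real parts; the imaginary part is the real part for `ih'`.
    · have e1 : Complex.I • φ.toFn (φ.mulFn (restrictSphere a) (V₀ h'))
          = fun z => restrictSphere a z • (Complex.I • h') :=
        funext fun z => smul_comm Complex.I (restrictSphere a z) h'
      have e2 : -φ.functional (rankOne (φ.toFn (V₀ h))
          (Complex.I • φ.toFn (φ.mulFn (restrictSphere a) (V₀ h'))))
          = -(⟪h, ν a (Complex.I • h')⟫_ℂ).re := by
        rw [e1]
        exact congrArg Neg.neg (hφ a h (Complex.I • h'))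
      refine Eq.trans e2 ?_
      rw [map_smul, inner_smul_right]
      simp
  let V : H →ₗᵢ[ℂ] φ.GNS :=
    { toLinearMap := (UniformSpace.Completion.toComplₗᵢ (𝕜 := ℂ) (E := φ.PreGNS)).toLinearMap ∘ₗ V₀
      -- Taking `a = 1` in `hinner`, unitality of `ν` makes the embedding by constant functions
      -- isometric.
      norm_map' := fun h => by
        change ‖((V₀ h : φ.PreGNS) : φ.GNS)‖ = ‖h‖
        rw [UniformSpace.Completion.norm_coe, ← sq_eq_sq₀ (norm_nonneg _) (norm_nonneg _),
          @norm_sq_eq_re_inner ℂ, @norm_sq_eq_re_inner ℂ H]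
        have e := hinner 1 h h
        rw [show ν 1 = 1 from h1, map_one] at e
        have e' : φ.mulFn 1 (V₀ h) = V₀ h := φ.toFn_injective (funext fun z => one_smul _ _)
        rw [e'] at e
        rw [e]
        rfl }
  refine ⟨φ.GNS, inferInstance, inferInstance, inferInstance, φ.gnsRep, φ.gnsNeilRep, V,
    φ.norm_gnsRep_le, φ.gnsNeilRep_apply, φ.gnsNeilRep_isCompletelyContractive, fun a => ?_⟩
  refine ContinuousLinearMap.ext fun h' => ext_inner_left ℂ fun h => ?_
  change _ = ⟪h, V.toContinuousLinearMap.adjoint (φ.gnsNeilRep a (V h'))⟫_ℂ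
  rw [ContinuousLinearMap.adjoint_inner_right, ← hinner a h h', φ.gnsNeilRep_apply]
  change _ = ⟪((V₀ h : φ.PreGNS) : φ.GNS),
    φ.gnsRep (restrictSphere a) ((V₀ h' : φ.PreGNS) : φ.GNS)⟫_ℂ
  rw [φ.gnsRep_coe, UniformSpace.Completion.inner_coe]

end GNS

/-! ### The Wold decomposition of a pure isometry -/

section Wold

variable {K : Type*} [NormedAddCommGroup K] [InnerProductSpace ℂ K]

theorem isClosed_map_linearIsometry [CompleteSpace K] {L : Submodule ℂ K} (hL : IsClosed (L : Set K))
    (U : K →ₗᵢ[ℂ] K) : IsClosed (L.map U.toLinearMap : Set K) :=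
  U.isometry.isClosedEmbedding.isClosedMap _ hL

theorem pow_mem_of_map_le {L : Submodule ℂ K} {U : K →ₗᵢ[ℂ] K} (hU : ∀ x ∈ L, U x ∈ L) (n : ℕ)
    {x : K} (hx : x ∈ L) : (U ^ n) x ∈ L := by
  induction n with
  | zero => exact hx
  | succ n ih => rw [pow_succ']; exact hU _ ih

/-- The wandering subspace of an isometry on an invariant subspace. -/
def wandering (L : Submodule ℂ K) (U : K →ₗᵢ[ℂ] K) : Submodule ℂ K :=
  L ⊓ (L.map U.toLinearMap)ᗮ

theorem isClosed_wandering {L : Submodule ℂ K} (hL : IsClosed (L : Set K)) (U : K →ₗᵢ[ℂ] K) :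
    IsClosed (wandering L U : Set K) :=
  hL.inter (Submodule.isClosed_orthogonal _)

/-- Cancelling the smaller power of the isometry leaves `⟪v, Uᵏ⁺¹w⟫`, which vanishes because `Uᵏ⁺¹w
∈ UL`. -/
theorem orthogonalFamily_wandering [CompleteSpace K] {L : Submodule ℂ K} {U : K →ₗᵢ[ℂ] K}
    (hU : ∀ x ∈ L, U x ∈ L) :
    OrthogonalFamily ℂ (fun _ : ℕ => wandering L U)
      (fun n => (U ^ n).comp (wandering L U).subtypeₗᵢ) := by
  have key : ∀ (n k : ℕ) (v w : wandering L U),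
      ⟪(U ^ n) (v : K), (U ^ (n + (k + 1))) (w : K)⟫_ℂ = 0 := by
    intro n k v w
    rw [pow_add]
    change ⟪(U ^ n) (v : K), (U ^ n) ((U ^ (k + 1)) (w : K))⟫_ℂ = 0
    rw [LinearIsometry.inner_map_map, pow_succ']
    exact Submodule.inner_left_of_mem_orthogonal (K := L.map U.toLinearMap)
      ⟨(U ^ k) (w : K), pow_mem_of_map_le hU k w.2.1, rfl⟩ v.2.2
  intro n m hnm v w
  change ⟪(U ^ n) (v : K), (U ^ m) (w : K)⟫_ℂ = 0
  rcases lt_or_gt_of_ne hnm with h | h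
  · obtain ⟨k, rfl⟩ := Nat.exists_eq_add_of_lt h
    exact key n k v w
  · obtain ⟨k, rfl⟩ := Nat.exists_eq_add_of_lt h
    rw [← inner_conj_symm, add_assoc, key m k w v, map_zero]

/-- A pure isometry is unitarily equivalent to multiplication by `z` on a Hardy space. -/
theorem exists_wold {K : Type w} [NormedAddCommGroup K] [InnerProductSpace ℂ K]
    [CompleteSpace K] {L : Submodule ℂ K} (hL : IsClosed (L : Set K)) {U : K →ₗᵢ[ℂ] K}
    (hU : ∀ x ∈ L, U x ∈ L)
    (hpure : ∀ x, (∀ n : ℕ, x ∈ L.map (U ^ n).toLinearMap) → x = 0) :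
    ∃ (N : Type w) (_ : NormedAddCommGroup N) (_ : InnerProductSpace ℂ N) (_ : CompleteSpace N)
      (J : Hardy N →ₗᵢ[ℂ] K), (LinearMap.range J.toLinearMap : Submodule ℂ K) = L ∧
      ∀ k f, J (mulOp (monomial_mem_discAlgebra k) f) = (U ^ k) (J f) := by
  have hcN : CompleteSpace (wandering L U) := (isClosed_wandering hL U).completeSpace_coe
  have hcU : CompleteSpace (L.map U.toLinearMap) :=
    (isClosed_map_linearIsometry hL U).completeSpace_coe
  have hfam := orthogonalFamily_wandering hU
  refine ⟨wandering L U, inferInstance, inferInstance, hcN,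
    hfam.linearIsometry.comp Hardy.coeffIsometry.toLinearIsometry, ?_, fun k f => ?_⟩
  · have hrange : LinearMap.range (hfam.linearIsometry.comp
        (Hardy.coeffIsometry (N := wandering L U)).toLinearIsometry).toLinearMap
        = (⨆ n, LinearMap.range
          ((U ^ n).comp (wandering L U).subtypeₗᵢ).toLinearMap).topologicalClosure := by
      rw [← hfam.range_linearIsometry]
      exact LinearMap.range_comp_of_range_eq_top _
        (LinearMap.range_eq_top.2 Hardy.coeffIsometry.surjective)
    rw [hrange]
    set X := ⨆ n, LinearMap.range ((U ^ n).comp (wandering L U).subtypeₗᵢ).toLinearMap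
    have hXL : X.topologicalClosure ≤ L := by
      refine Submodule.topologicalClosure_minimal _ (iSup_le fun n => ?_) hL
      rintro _ ⟨c, rfl⟩
      exact pow_mem_of_map_le hU n c.2.1
    refine le_antisymm hXL fun x hx => ?_
    have hcX : CompleteSpace X.topologicalClosure :=
      X.isClosed_topologicalClosure.completeSpace_coe
    obtain ⟨p, hp, q, hq, rfl⟩ := X.topologicalClosure.exists_add_mem_mem_orthogonal x
    have hqL : q ∈ L := (Submodule.add_mem_iff_right L (hXL hp)).1 hx
    suffices q = 0 by rwa [this, add_zero]
    -- A vector of `L` orthogonal to all `UⁿN` lies in every `UⁿL`. Inductively `q = Uⁿ(a + b)` with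
    -- `a ∈ UL` and `b` wandering; orthogonality to `Uⁿb` gives `‖b‖² = 0`, so `q ∈ Uⁿ⁺¹L`.
    refine hpure q fun n => ?_
    induction n with
    | zero => exact ⟨q, hqL, rfl⟩
    | succ n ih =>
      obtain ⟨y, hy, rfl⟩ := ih
      obtain ⟨a, ha, b, hb, rfl⟩ :=
        (L.map U.toLinearMap).exists_add_mem_mem_orthogonal y
      have haL : a ∈ L := by
        obtain ⟨a', ha', rfl⟩ := ha
        exact hU _ ha'
      have hbN : b ∈ wandering L U := ⟨(Submodule.add_mem_iff_right L haL).1 hy, hb⟩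
      have h1 : ⟪(U ^ n) b, (U ^ n) (a + b)⟫_ℂ = 0 :=
        Submodule.inner_right_of_mem_orthogonal (X.le_topologicalClosure
          (Submodule.mem_iSup_of_mem n ⟨⟨b, hbN⟩, rfl⟩)) hq
      rw [LinearIsometry.inner_map_map, inner_add_right,
        Submodule.inner_left_of_mem_orthogonal ha hb, zero_add, inner_self_eq_zero] at h1
      obtain ⟨a', ha', rfl⟩ := ha
      refine ⟨a', ha', ?_⟩
      rw [h1, add_zero, pow_succ]
      rfl
  -- The coefficients of `zᵏf` are those of `f` delayed by `k` places, so the first `k` terms drop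
  -- out and the remaining series match term by term.
  · have h1 := hfam.hasSum_linearIsometry
      (Hardy.coeffIsometry (mulOp (monomial_mem_discAlgebra k) f))
    have h2 := (hasSum_nat_add_iff' k).2 h1
    rw [Finset.sum_eq_zero, sub_zero] at h2
    · have h3 := (hfam.hasSum_linearIsometry (Hardy.coeffIsometry f)).mapL
        (U ^ k).toContinuousLinearMap
      refine h2.unique ?_
      convert h3 using 2 with n
      · change (U ^ (n + k)) ((taylorCoeff (mulOp (monomial_mem_discAlgebra k) f) (n + k) :
          wandering L U) : K) = (U ^ k) ((U ^ n) (taylorCoeff f n : wandering L U))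
        rw [taylorCoeff_mulOp_monomial_add, add_comm, pow_add]
        rfl
      · rfl
    · intro n hn
      change (U ^ n) ((taylorCoeff (mulOp (monomial_mem_discAlgebra k) f) n :
        wandering L U) : K) = 0
      rw [taylorCoeff_mulOp_monomial_of_lt (Finset.mem_range.1 hn), ZeroMemClass.coe_zero, map_zero]

end Wold

/-! ### Representations of the continuous functions on the circle -/

section Circle

variable {K : Type*} [NormedAddCommGroup K] [InnerProductSpace ℂ K]

/-- The coordinate function on the circle. -/
def circleCoord : C(unitSphere, ℂ) := ⟨fun z => z, by fun_prop⟩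

theorem restrictSphere_neilMonomial {n : ℕ} (hn : n ≠ 1) :
    restrictSphere (neilMonomial hn) = circleCoord ^ n := by
  ext z
  rw [restrictSphere_apply, neilMonomial,
    discExt_monomial n (Metric.sphere_subset_closedBall z.2)]
  rfl

theorem norm_circleCoord_le : ‖circleCoord‖ ≤ 1 :=
  (ContinuousMap.norm_le _ zero_le_one).2 fun z => (mem_sphere_zero_iff_norm.1 z.2).le

theorem star_circleCoord_mul : star circleCoord * circleCoord = 1 := by
  ext z
  change (starRingEnd ℂ) (z : ℂ) * z = 1
  rw [mul_comm, Complex.mul_conj, Complex.normSq_eq_norm_sq, mem_sphere_zero_iff_norm.1 z.2]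
  simp

variable {M : C(unitSphere, ℂ) →ₐ[ℂ] (K →L[ℂ] K)}

/-- The unitary operator given by the coordinate function. -/
def coordIsometry (hM : ∀ c x, ‖M c x‖ ≤ ‖c‖ * ‖x‖) : K →ₗᵢ[ℂ] K where
  toLinearMap := (M circleCoord).toLinearMap
  norm_map' x := by
    refine le_antisymm ?_ ?_
    · exact (hM _ x).trans (mul_le_of_le_one_left (norm_nonneg _) norm_circleCoord_le)
    -- `M(z)` has the contractive left inverse `M(z̄)`, so it cannot shrink norms. Compatibility of
    -- `M` with adjoints is not needed.
    · have h : M (star circleCoord) (M circleCoord x) = x := by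
        change (M (star circleCoord) * M circleCoord) x = x
        rw [← map_mul, star_circleCoord_mul, map_one]
        rfl
      conv_lhs => rw [← h]
      exact (hM _ _).trans (mul_le_of_le_one_left (norm_nonneg _)
        (by rw [norm_star]; exact norm_circleCoord_le))

theorem coordIsometry_pow_apply (hM : ∀ c x, ‖M c x‖ ≤ ‖c‖ * ‖x‖) (n : ℕ) (x : K) :
    (coordIsometry hM ^ n) x = M (circleCoord ^ n) x := by
  induction n generalizing x with
  | zero => rw [pow_zero, pow_zero, map_one]; rfl
  | succ n ih =>
    rw [pow_succ, pow_succ, map_mul]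
    exact ih _

theorem coordIsometry_star (hM : ∀ c x, ‖M c x‖ ≤ ‖c‖ * ‖x‖) (x : K) :
    coordIsometry hM (M (star circleCoord) x) = x := by
  change (M circleCoord * M (star circleCoord)) x = x
  rw [← map_mul, mul_comm, star_circleCoord_mul, map_one]
  rfl

theorem continuous_restrictSphere_apply (hM : ∀ c x, ‖M c x‖ ≤ ‖c‖ * ‖x‖) (x : K) :
    Continuous fun a => M (restrictSphere a) x := by
  have h1 : Continuous fun c => M c x :=
    AddMonoidHomClass.continuous_of_bound
      ((ContinuousLinearMap.apply ℂ K x).toLinearMap.comp M.toLinearMap) ‖x‖ fun c => by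
        rw [mul_comm]
        exact hM c x
  have h2 : Continuous (restrictSphere : neilAlgebra → C(unitSphere, ℂ)) :=
    (ContinuousMap.continuous_precomp _).comp continuous_subtype_val
  exact h1.comp h2

/-- Closed subspaces invariant under the coordinate function are invariant under the Neil
algebra. -/
theorem apply_restrictSphere_mem (hM : ∀ c x, ‖M c x‖ ≤ ‖c‖ * ‖x‖) {Y : Submodule ℂ K}
    (hY : IsClosed (Y : Set K)) (hUY : ∀ y ∈ Y, coordIsometry hM y ∈ Y) (a : neilAlgebra) {y : K}
    (hy : y ∈ Y) : M (restrictSphere a) y ∈ Y := by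
  have hcl : IsClosed {a : neilAlgebra | M (restrictSphere a) y ∈ Y} :=
    hY.preimage (continuous_restrictSphere_apply hM y)
  refine closure_minimal (fun a ha => ?_) hcl (dense_span_neilMonomial a)
  let S : neilAlgebra →ₗ[ℂ] K := (ContinuousLinearMap.apply ℂ K y).toLinearMap ∘ₗ
    (M.comp restrictSphere).toLinearMap
  refine (Submodule.span_le (p := Y.comap S)).2 ?_ ha
  rintro _ ⟨n, hn, rfl⟩
  change M (restrictSphere (neilMonomial hn)) y ∈ Y
  rw [restrictSphere_neilMonomial, ← coordIsometry_pow_apply hM]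
  exact pow_mem_of_map_le hUY n hy

variable [CompleteSpace K]

/-- The operator given by a function in the Neil algebra without zeros on the circle maps every
closed subspace that reduces the coordinate function onto itself. -/
theorem exists_mem_apply_restrictSphere_eq (hM : ∀ c x, ‖M c x‖ ≤ ‖c‖ * ‖x‖) {R : Submodule ℂ K}
    (hR : IsClosed (R : Set K)) (hUR : ∀ y ∈ R, coordIsometry hM y ∈ R)
    (hUR' : ∀ y ∈ R, M (star circleCoord) y ∈ R) {a : neilAlgebra}
    (ha : ∀ z : ℂ, ‖z‖ = 1 → discExt (a : C(_, ℂ)) z ≠ 0) {x : K} (hx : x ∈ R) :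
    ∃ y ∈ R, M (restrictSphere a) y = x := by
  have ha' : ∀ z, restrictSphere a z ≠ 0 := fun z => by
    rw [restrictSphere_apply]; exact ha z (mem_sphere_zero_iff_norm.1 z.2)
  let c : C(unitSphere, ℂ) :=
    ⟨fun z => (restrictSphere a z)⁻¹, (restrictSphere a).continuous.inv₀ ha'⟩
  have hc : restrictSphere a * c = 1 := by
    ext z
    exact mul_inv_cancel₀ (ha' z)
  have hRc : CompleteSpace R := hR.completeSpace_coe
  -- The inverse `1/a` is only continuous on the circle, so invariance of `R` under `M c` is not
  -- immediate. Instead `M(c)x` is split along `R` and `Rᗮ`, both invariant under `M(a)`. The image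
  -- of the second component lies in `R ∩ Rᗮ = 0`.
  have hUp : ∀ y ∈ Rᗮ, coordIsometry hM y ∈ Rᗮ := by
    intro y hy r hr
    rw [← coordIsometry_star hM r, LinearIsometry.inner_map_map]
    exact hy _ (hUR' r hr)
  have h1 : M (restrictSphere a) (M c x) = x := by
    change (M (restrictSphere a) * M c) x = x
    rw [← map_mul, hc, map_one]
    rfl
  obtain ⟨y, hy, y', hy', hsum⟩ := R.exists_add_mem_mem_orthogonal (M c x)
  refine ⟨y, hy, ?_⟩
  have h2 := apply_restrictSphere_mem hM hR hUR a hy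
  have h3 := apply_restrictSphere_mem hM R.isClosed_orthogonal hUp a hy'
  rw [hsum, map_add] at h1
  have h4 : M (restrictSphere a) y' ∈ R := (Submodule.add_mem_iff_right R h2).1 (h1 ▸ hx)
  have h5 : M (restrictSphere a) y' = 0 := inner_self_eq_zero.1 (h3 _ h4)
  rwa [h5, add_zero] at h1

end Circle

/-! ### The model of a pure extremal representation -/

section Model

/-- Subspaces of the Hardy space orthogonal to `z² H²` consist of polynomials of degree one. -/
theorem mem_linearPart_of_inner_eq_zero {N : Type*} [NormedAddCommGroup N] [InnerProductSpace ℂ N]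
    [CompleteSpace N] {v : Hardy N}
    (hv : ∀ f : Hardy N, ⟪mulOp (monomial_mem_discAlgebra 2) f, v⟫_ℂ = 0) : v ∈ linearPart N := by
  have h0 : ∀ n, taylorCoeff v (n + 2) = 0 := by
    intro n
    -- For `f = zⁿ v̂(n+2)` the inner product of `z²f` with `v` is `‖v̂(n+2)‖²`.
    let f : Hardy N := Hardy.coeffEquiv.symm (lp.single 2 n (taylorCoeff v (n + 2)))
    have hf : ∀ m, taylorCoeff f m = (Pi.single n (taylorCoeff v (n + 2)) : ℕ → N) m := by
      intro m
      rw [← Hardy.coeffEquiv_apply, LinearEquiv.apply_symm_apply]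
      rfl
    have h := hv f
    rw [Hardy.inner_eq_tsum, tsum_eq_single (n + 2), taylorCoeff_mulOp_monomial_add, hf,
      Pi.single_eq_same, inner_self_eq_zero] at h
    · exact h
    · intro m hm
      rcases lt_or_ge m 2 with h2 | h2
      · rw [taylorCoeff_mulOp_monomial_of_lt h2, inner_zero_left]
      · obtain ⟨m, rfl⟩ := Nat.exists_eq_add_of_le' h2
        rw [taylorCoeff_mulOp_monomial_add, hf, Pi.single_eq_of_ne (by omega), inner_zero_left]
  refine ⟨taylorCoeff v 0, taylorCoeff v 1, fun z hz => ?_⟩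
  have h1 := hasSum_taylorCoeff v.differentiableOn hz
  have h2 : HasSum (fun n => z ^ n • taylorCoeff v n)
      (∑ n ∈ Finset.range 2, z ^ n • taylorCoeff v n) := by
    refine hasSum_sum_of_ne_finset_zero fun n hn => ?_
    obtain ⟨m, rfl⟩ := Nat.exists_eq_add_of_le' (not_lt.1 (fun h => hn (Finset.mem_range.2 h)))
    rw [h0, smul_zero]
  rw [h1.unique h2]
  simp [Finset.sum_range_succ]

/-- A pure representation that extends to the continuous functions on the circle is unitarily
equivalent to a multiplication representation. -/
theorem IsPure.exists_unitarilyEquivalent {H : Type w} [NormedAddCommGroup H]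
    [InnerProductSpace ℂ H] [CompleteSpace H] {ν : neilAlgebra →ₙₐ[ℂ] (H →L[ℂ] H)} (hν : IsPure ν)
    {K : Type w} [NormedAddCommGroup K] [InnerProductSpace ℂ K] [CompleteSpace K]
    {M : C(unitSphere, ℂ) →ₐ[ℂ] (K →L[ℂ] K)} (hM : ∀ c x, ‖M c x‖ ≤ ‖c‖ * ‖x‖)
    (T : H →ₗᵢ[ℂ] K) (hT : ∀ a h, T (ν a h) = M (restrictSphere a) (T h)) :
    ∃ (N : Type w) (_ : NormedAddCommGroup N) (_ : InnerProductSpace ℂ N) (_ : CompleteSpace N)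
      (V : Submodule ℂ (Hardy N)) (hV : V ≤ linearPart N),
      IsClosed (V : Set (Hardy N)) ∧ UnitarilyEquivalent ν (mulRep V hV) := by
  let U := coordIsometry hM
  let X : Submodule ℂ K := LinearMap.range T.toLinearMap
  have hXc : IsClosed (X : Set K) := by
    have := T.isometry.isClosedEmbedding.isClosed_range
    exact this
  have hUX : ∀ (n : ℕ), n ≠ 1 → ∀ x ∈ X, (U ^ n) x ∈ X := by
    rintro n hn _ ⟨h, rfl⟩
    refine ⟨ν (neilMonomial hn) h, (hT _ _).trans ?_⟩
    rw [restrictSphere_neilMonomial, ← coordIsometry_pow_apply hM]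
    rfl
  -- The function `z` is missing from the algebra; adjoining `UX` produces a space invariant under
  -- `U` itself, since `U²X ⊆ X`.
  let L : Submodule ℂ K := (X ⊔ X.map U.toLinearMap).topologicalClosure
  have hLc : IsClosed (L : Set K) := Submodule.isClosed_topologicalClosure _
  have hXL : X ≤ L := le_sup_left.trans (Submodule.le_topologicalClosure _)
  have hUL : ∀ x ∈ L, U x ∈ L := by
    have : L ≤ L.comap U.toLinearMap := by
      refine Submodule.topologicalClosure_minimal _ (sup_le ?_ ?_) (hLc.preimage U.continuous)
      · intro x hx
        exact Submodule.le_topologicalClosure _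
          (Submodule.mem_sup_right (Submodule.mem_map_of_mem hx))
      · rintro _ ⟨x, hx, rfl⟩
        exact hXL (hUX 2 (by norm_num) x hx)
    exact this
  -- This rests on `U²X ⊆ X` and `U³X ⊆ X`.
  have hU2 : ∀ x ∈ L, (U ^ 2) x ∈ X := by
    have : L ≤ X.comap (U ^ 2).toLinearMap := by
      refine Submodule.topologicalClosure_minimal _ (sup_le ?_ ?_)
        (hXc.preimage (U ^ 2).continuous)
      · intro x hx
        exact hUX 2 (by norm_num) x hx
      · rintro _ ⟨x, hx, rfl⟩
        exact hUX 3 (by norm_num) x hx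
    exact this
  have hpure : ∀ x, (∀ n : ℕ, x ∈ L.map (U ^ n).toLinearMap) → x = 0 := by
    let R : Submodule ℂ K := ⨅ n : ℕ, L.map (U ^ n).toLinearMap
    have hRc : IsClosed (R : Set K) := by
      rw [Submodule.coe_iInf]
      exact isClosed_iInter fun n => isClosed_map_linearIsometry hLc (U ^ n)
    have hR : ∀ {x}, x ∈ R ↔ ∀ n : ℕ, x ∈ L.map (U ^ n).toLinearMap := Submodule.mem_iInf _
    have hUR : ∀ y ∈ R, U y ∈ R := by
      intro y hy
      rw [hR] at hy ⊢
      rintro (_ | n)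
      · obtain ⟨l, hl, rfl⟩ := hy 0
        exact ⟨U l, hUL l hl, rfl⟩
      · obtain ⟨l, hl, rfl⟩ := hy n
        refine ⟨l, hl, ?_⟩
        rw [pow_succ']
        rfl
    have hUR' : ∀ y ∈ R, M (star circleCoord) y ∈ R := by
      intro y hy
      rw [hR] at hy ⊢
      intro n
      obtain ⟨l, hl, hly⟩ := hy (n + 1)
      refine ⟨l, hl, U.injective ?_⟩
      refine Eq.trans ?_ (coordIsometry_star hM y).symm
      rw [← hly, pow_succ']
      rfl
    -- `R ⊆ U²L ⊆ X`. This lets purity of `ν`, a statement about `X` alone, act on `R`.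
    have hRX : R ≤ X := by
      intro y hy
      obtain ⟨l, hl, rfl⟩ := hR.1 hy 2
      exact hU2 l hl
    intro x hx
    have hxR := hR.2 hx
    obtain ⟨h, rfl⟩ := hRX hxR
    have : h ∈ ({0} : Set H) := by
      rw [← hν]
      refine Set.mem_iInter₂.2 fun a ha => ?_
      obtain ⟨y, hy, hya⟩ := exists_mem_apply_restrictSphere_eq hM hRc hUR hUR' ha hxR
      obtain ⟨h', rfl⟩ := hRX hy
      exact ⟨h', T.injective ((hT a h').trans hya)⟩
    rw [Set.mem_singleton_iff.1 this]
    exact T.map_zero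
  obtain ⟨N, _, _, _, J, hJ, hJU⟩ := exists_wold hLc hUL hpure
  have hJM : ∀ (a : neilAlgebra) (f : Hardy N),
      J (mulOp a.2.1 f) = M (restrictSphere a) (J f) := by
    intro a f
    have hf : f ∈ (⊥ : Submodule ℂ (Hardy N))ᗮ := by simp
    -- The multiplication representation with `V = 0` supplies the continuity of `a ↦ af`, so that
    -- comparison on monomials suffices.
    let Y : Submodule ℂ (Hardy N) := ⊥ᗮ
    let π : neilAlgebra →ₙₐ[ℂ] (Y →L[ℂ] Y) := mulRep ⊥ bot_le
    let A : neilAlgebra →ₗ[ℂ] K := J.toLinearMap ∘ₗ Y.subtype ∘ₗ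
      (ContinuousLinearMap.apply ℂ Y (⟨f, hf⟩ : Y)).toLinearMap ∘ₗ
      { toFun := π, map_add' := map_add π, map_smul' := map_smul π }
    let B : neilAlgebra →ₗ[ℂ] K := (ContinuousLinearMap.apply ℂ K (J f)).toLinearMap ∘ₗ
      (M.comp restrictSphere).toLinearMap
    have hAB : A = B := by
      refine eq_of_eq_neilMonomial ?_ (continuous_restrictSphere_apply hM (J f)) fun n hn => ?_
      · exact J.continuous.comp (continuous_subtype_val.comp
          ((mulRep_isCompletelyContractive ⊥ bot_le).continuous_apply _))
      · change J (mulOp (monomial_mem_discAlgebra n) f) = M (restrictSphere (neilMonomial hn)) (J f)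
        rw [hJU, coordIsometry_pow_apply, restrictSphere_neilMonomial]
    exact LinearMap.congr_fun hAB a
  let P : Submodule ℂ (Hardy N) := X.comap J.toLinearMap
  have hPc : IsClosed (P : Set (Hardy N)) := hXc.preimage J.continuous
  have hPcomplete : CompleteSpace P := hPc.completeSpace_coe
  -- Since `U²L ⊆ X`, the subspace `P` contains `z²H²`.
  have hV : Pᗮ ≤ linearPart N := fun v hv => mem_linearPart_of_inner_eq_zero fun f => by
    refine hv _ ?_
    change J _ ∈ X
    rw [hJU]
    exact hU2 _ (hJ ▸ ⟨f, rfl⟩)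
  have hPP : Pᗮᗮ = P := Submodule.orthogonal_orthogonal P
  let S : H →ₗᵢ[ℂ] Hardy N := J.equivRange.symm.toLinearIsometry.comp
    { toLinearMap := T.toLinearMap.codRestrict _ fun h => hJ.symm ▸ hXL ⟨h, rfl⟩
      norm_map' := T.norm_map }
  have hJS : ∀ h, J (S h) = T h := fun h =>
    congrArg Subtype.val (J.equivRange.apply_symm_apply ⟨T h, hJ.symm ▸ hXL ⟨h, rfl⟩⟩)
  have hSP : ∀ h, S h ∈ Pᗮᗮ := fun h => by
    rw [hPP]
    exact ⟨h, (hJS h).symm⟩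
  -- With `V = Pᗮ` the model acts on `Pᗮᗮ`, which is `P` because `P` is closed.
  refine ⟨N, _, _, _, Pᗮ, hV, P.isClosed_orthogonal, LinearIsometryEquiv.ofSurjective
    { toLinearMap := S.toLinearMap.codRestrict _ hSP
      norm_map' := S.norm_map } ?_, fun a h => ?_⟩
  · rintro ⟨f, hf⟩
    obtain ⟨h, hh⟩ := hPP.le hf
    exact ⟨h, Subtype.ext (J.injective ((hJS h).trans hh))⟩
  · refine Subtype.ext (J.injective ?_)
    change J (S (ν a h)) = J (mulOp a.2.1 (S h))
    rw [hJS, hT, hJM, hJS]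

end Model

end NeilRep

end

theorem theorem4p1 :
    (∀ (N : Type u) [NormedAddCommGroup N] [InnerProductSpace ℂ N] [CompleteSpace N]
      (V : Submodule ℂ (NeilRep.Hardy N)) (hV : V ≤ NeilRep.linearPart N),
      NeilRep.IsUnital (NeilRep.mulRep V hV) ∧
      NeilRep.IsPure (NeilRep.mulRep V hV) ∧
      NeilRep.IsCompletelyContractive (NeilRep.mulRep V hV) ∧
      NeilRep.IsExtremal.{v} (NeilRep.mulRep V hV)) ∧
    (∀ (H : Type w) [NormedAddCommGroup H] [InnerProductSpace ℂ H] [CompleteSpace H]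
      (ν : NeilRep.neilAlgebra →ₙₐ[ℂ] (H →L[ℂ] H)),
      NeilRep.IsUnital ν → NeilRep.IsPure ν → NeilRep.IsCompletelyContractive ν →
      NeilRep.IsExtremal.{w} ν →
      ∃ (N : Type w) (_ : NormedAddCommGroup N) (_ : InnerProductSpace ℂ N) (_ : CompleteSpace N)
        (V : Submodule ℂ (NeilRep.Hardy N)) (hV : V ≤ NeilRep.linearPart N),
        IsClosed (V : Set (NeilRep.Hardy N)) ∧
        NeilRep.UnitarilyEquivalent ν (NeilRep.mulRep V hV)) := by
  refine ⟨fun N _ _ _ V hV => ⟨NeilRep.mulRep_isUnital V hV, NeilRep.mulRep_isPure V hV,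
    NeilRep.mulRep_isCompletelyContractive V hV, NeilRep.mulRep_isExtremal V hV⟩,
    fun H _ _ _ ν h1 hpure hcc hext => ?_⟩
  obtain ⟨K, _, _, _, M, ρ, T, hM, hρM, hρ, hT⟩ := hcc.exists_dilation h1
  refine hpure.exists_unitarilyEquivalent hM T fun a h => ?_
  rw [← hρM]
  -- Extremality, applied to the restriction `ρ` of `M` to the Neil algebra, turns the compression
  -- into an intertwining relation.
  exact DFunLike.congr_fun (hext K ρ hρ T hT a) h
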